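/- Let $\mathbb E^4_2$ be $\mathbb R^4$ with the scalar product $\langle v,w\rangle=-v_1w_1-v_2w_2+v_3w_3+v_4w_4$ and let $\mathbb H^3_1=\{v\in\mathbb E^4_2:\langle v,v\rangle=-1\}$ be anti-de Sitter space. Let $M$ be an oriented Lorentzian surface, isometrically immersed in $\mathbb H^3_1$ by $\mathbf x:M\to\mathbb H^3_1\subset\mathbb E^4_2$, with constant mean curvature, constant Gaussian curvature and non-diagonalizable shape operator (at some point). Its pseudo-hyperbolic Gauss map is $$\tilde\nu:M\to\textstyle\bigwedge^3\mathbb E^4_2,\qquad \tilde\nu(p)=\mathbf x(p)\wedge\mathbf x_*(e_1)\wedge\mathbf x_*(e_2),$$ where $(e_1,e_2)$ is any positively oriented orthonormal frame of $T_pM$. Let $\Delta=\sum_i\varepsilon_i(\nabla_{e_i}e_i-e_ie_i)$ be the Laplacian of $M$, where $\varepsilon_i=\langle e_i,e_i\rangle$. A smooth map $\phi$ from $M$ to a finite-dimensional real vector space is of finite type if $\phi=\phi_1+\dots+\phi_k$ for some $k\ge 1$ and smooth non-constant maps $\phi_i$ with $\Delta\phi_i=\lambda_i\phi_i$, $\lambda_i\in\mathbb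 R$; it is of infinite type otherwise. If such a decomposition exists with mutually distinct $\lambda_1,\dots,\lambda_k$, then $\phi$ is of $k$-type, and of null $k$-type if moreover one of the $\lambda_i$ is $0$. For $\kappa\in\mathbb C$, the complex circle of radius $\kappa$ is $\{(z_1,z_2)\in\mathbb C^2: z_1^2+z_2^2=\kappa\}$, where $\mathbb C^2$ with the form $\mathrm{Re}(z_1w_1+z_2w_2)$ is identified with $\mathbb E^4_2$; it lies in $\mathbb H^3_1$ if $\mathrm{Re}\,\kappa=-1$. A B-scroll is a surface parametrized by $\mathbf x(s,t)=\gamma(s)+tB(s)$, $(s,t)\in I\times\mathbb R$ with $I$ an open interval, where $\gamma:I\to\mathbb H^3_1$ is a null curve with a Cartan frame $(A,B,C)$, i.e. smooth vector fields tangent to $\mathbb H^3_1$ along $\gamma$ with $\langle A,A\rangle=\langle B,B\rangle=\langle A,C\rangle=\langle B,C\rangle=0$, $\langle A,B\rangle=-1$, $\langle C,C\rangle=1$ and $$\dot\gamma=A,\quad \dot A=k_1C,\quad \dot C=k_2A+k_1B,\quad \dot B=k_2C-\gamma,$$ with a smooth function $k_1>0$ and a constant $k_2>0$. It is flat if its Gaussian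 curvature vanishes identically. Then: (i) if $M$ is the complex circle of radius $-1$, then $\tilde\nu$ is of $1$-type; (ii) if $M$ is the complex circle of radius $\kappa$ with $\mathrm{Re}\,\kappa=-1$ and $\kappa\neq-1$, then $\tilde\nu$ is of infinite type; (iii) if $M$ is a non-flat B-scroll, then $\tilde\nu$ is of null $2$-type; (iv) if $M$ is a flat B-scroll, then $\tilde\nu$ is of infinite type. -/

import Mathlib

open scoped Manifold ContDiff

noncomputable section

namespace LorentzSurface

/-- Coordinate plane on which surfaces are modelled. -/
abbrev Plane : Type := EuclideanSpace ℝ (Fin 2)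

/-- The vector space underlying the pseudo-Euclidean space `𝔼⁴₂`. -/
abbrev E42 : Type := Fin 4 → ℝ

/-- The scalar product of index `2`. -/
def ip (v w : E42) : ℝ := -(v 0 * w 0) - v 1 * w 1 + v 2 * w 2 + v 3 * w 3

/-- Anti-de Sitter space `ℍ³₁`. -/
def antiDeSitter : Set E42 := {v | ip v v = -1}

/-! ### Pseudo-Riemannian geometry in a coordinate chart of the plane -/

/-- The `i`-th partial derivative of a map defined on the coordinate plane. -/
def pd {F : Type*} [NormedAddCommGroup F] [NormedSpace ℝ F] (i : Fin 2) (f : Plane → F)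
    (u : Plane) : F :=
  fderiv ℝ f u (EuclideanSpace.single i 1)

/-- Christoffel symbol `Γᵏᵢⱼ` of the Levi-Civita connection of the metric with components `g`. -/
def christoffel (g : Plane → Matrix (Fin 2) (Fin 2) ℝ) (k i j : Fin 2) (u : Plane) : ℝ :=
  (1 / 2) * ∑ l, (g u)⁻¹ k l *
    (pd i (fun v => g v j l) u + pd j (fun v => g v i l) u - pd l (fun v => g v i j) u)

/-- The Laplacian `-gⁱʲ (∂ᵢ∂ⱼ f - Γᵏᵢⱼ ∂ₖ f)`, i.e. `∑ εᵢ (∇_{eᵢ} eᵢ - eᵢ eᵢ) f` for an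
orthonormal frame `(eᵢ)`. -/
def coordLaplacian (g : Plane → Matrix (Fin 2) (Fin 2) ℝ) (f : Plane → ℝ) (u : Plane) : ℝ :=
  -∑ i, ∑ j, (g u)⁻¹ i j * (pd i (pd j f) u - ∑ k, christoffel g k i j u * pd k f u)

/-- Component `Rˡₖᵢⱼ` of the curvature tensor: `R(∂ᵢ, ∂ⱼ) ∂ₖ = ∑ₗ Rˡₖᵢⱼ ∂ₗ`, where
`R(X, Y) = [∇_X, ∇_Y] - ∇_[X, Y]`. -/
def coordCurvature (g : Plane → Matrix (Fin 2) (Fin 2) ℝ) (l k i j : Fin 2) (u : Plane) : ℝ :=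
  pd i (christoffel g l j k) u - pd j (christoffel g l i k) u
    + ∑ m, (christoffel g l i m u * christoffel g m j k u
      - christoffel g l j m u * christoffel g m i k u)

/-- Gaussian curvature `⟨R(∂₀, ∂₁) ∂₁, ∂₀⟩ / (g₀₀ g₁₁ - g₀₁²)`. -/
def coordGaussianCurvature (g : Plane → Matrix (Fin 2) (Fin 2) ℝ) (u : Plane) : ℝ :=
  (∑ l, g u 0 l * coordCurvature g l 1 0 1 u) / (g u).det

/-! ### Immersed surfaces -/

section Surface

variable {M : Type*} [TopologicalSpace M] [ChartedSpace Plane M]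

/-- All coordinate changes of the given atlas have positive Jacobian determinant, so that the
atlas orients `M`: the charts are the positively oriented ones. -/
def IsOrientedAtlas (M : Type*) [TopologicalSpace M] [ChartedSpace Plane M] : Prop :=
  ∀ e ∈ atlas Plane M, ∀ e' ∈ atlas Plane M, ∀ u ∈ (e.symm.trans e').source,
    0 < (fderiv ℝ (e.symm.trans e') u).det

/-- Differential of a map into `𝔼⁴₂`. -/
def diff (x : M → E42) (p : M) (v : TangentSpace (𝓡 2) p) : E42 :=
  mfderiv (𝓡 2) 𝓘(ℝ, E42) x p v

/-- The metric on `M` induced by `x`. -/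
def inducedMetric (x : M → E42) (p : M) (v w : TangentSpace (𝓡 2) p) : ℝ :=
  ip (diff x p v) (diff x p w)

/-- `x` is an immersion of `M` into `ℍ³₁` whose induced metric is Lorentzian (index `1`). -/
structure IsLorentzianSurface (x : M → E42) : Prop where
  smooth : ContMDiff (𝓡 2) 𝓘(ℝ, E42) ∞ x
  mem : ∀ p, x p ∈ antiDeSitter
  immersion : ∀ p, Function.Injective (diff x p)
  lorentzian : ∀ p, ∃ e₁ e₂ : TangentSpace (𝓡 2) p,
    inducedMetric x p e₁ e₁ = -1 ∧ inducedMetric x p e₂ e₂ = 1 ∧ inducedMetric x p e₁ e₂ = 0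

/-- Components of the induced metric in the preferred chart at `p`. -/
def localMetric (x : M → E42) (p : M) (u : Plane) : Matrix (Fin 2) (Fin 2) ℝ :=
  Matrix.of fun i j =>
    ip (pd i (x ∘ (chartAt Plane p).symm) u) (pd j (x ∘ (chartAt Plane p).symm) u)

/-- The Laplacian of the induced metric on functions; its value at `p` is computed in the
preferred chart at `p`. -/
def laplacian (x : M → E42) (f : M → ℝ) (p : M) : ℝ :=
  coordLaplacian (localMetric x p) (f ∘ (chartAt Plane p).symm) (chartAt Plane p p)

/-- The Gaussian curvature of the induced metric. -/
def gaussianCurvature (x : M → E42) (p : M) : ℝ :=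
  coordGaussianCurvature (localMetric x p) (chartAt Plane p p)

def IsFlat (x : M → E42) : Prop := ∀ p, gaussianCurvature x p = 0

/-- `N` is a unit normal vector field of the surface in `ℍ³₁`. -/
structure IsUnitNormal (x N : M → E42) : Prop where
  smooth : ContMDiff (𝓡 2) 𝓘(ℝ, E42) ∞ N
  tangent : ∀ p, ip (N p) (x p) = 0
  normal : ∀ p v, ip (N p) (diff x p v) = 0
  unit : ∀ p, ip (N p) (N p) = 1

/-- `S` is the shape operator in the direction `N`: `x_*(S v) = -D_v N`. -/
def IsShapeOperator (x N : M → E42)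
    (S : ∀ p : M, TangentSpace (𝓡 2) p →ₗ[ℝ] TangentSpace (𝓡 2) p) : Prop :=
  ∀ p v, diff x p (S p v) = -diff N p v

/-- The mean curvature: half the trace of the shape operator. -/
def meanCurvature (S : ∀ p : M, TangentSpace (𝓡 2) p →ₗ[ℝ] TangentSpace (𝓡 2) p) (p : M) : ℝ :=
  LinearMap.trace ℝ (TangentSpace (𝓡 2) p) (S p) / 2

/-- There is a basis of eigenvectors (over `ℝ`). -/
def IsDiagonalizable {V : Type*} [AddCommGroup V] [Module ℝ V] (T : V →ₗ[ℝ] V) : Prop :=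
  (⨆ μ : ℝ, Module.End.eigenspace T μ) = ⊤

/-- `(e₁, e₂)` is an orthonormal frame of the tangent plane at `p` that is compatible with the
orientation given by the atlas; a tangent vector at `p` is represented by its components in the
preferred chart at `p`. -/
structure IsPositiveOrthonormalFrame (x : M → E42) (p : M)
    (e₁ e₂ : TangentSpace (𝓡 2) p) : Prop where
  unit₁ : |inducedMetric x p e₁ e₁| = 1
  unit₂ : |inducedMetric x p e₂ e₂| = 1
  orthogonal : inducedMetric x p e₁ e₂ = 0
  positive : 0 < (EuclideanSpace.basisFun (Fin 2) ℝ).toBasis.det ![(e₁ : Plane), (e₂ : Plane)]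

/-- `ν` is the pseudo-hyperbolic Gauss map `p ↦ x(p) ∧ x_*(e₁) ∧ x_*(e₂)`. -/
def IsGaussMap (x : M → E42) (ν : M → ⋀[ℝ]^3 E42) : Prop :=
  ∀ (p : M) (e₁ e₂ : TangentSpace (𝓡 2) p), IsPositiveOrthonormalFrame x p e₁ e₂ →
    ν p = exteriorPower.ιMulti ℝ 3 ![x p, diff x p e₁, diff x p e₂]

/-! ### Maps of finite type into a finite-dimensional real vector space

Smoothness and the Laplacian of a vector-valued map are taken componentwise, a component being
the composition with a linear functional. -/

variable {V : Type*} [AddCommGroup V] [Module ℝ V]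

/-- `φ` is smooth, non-constant, and `Δ φ = c φ`. -/
structure IsEigenmap (x : M → E42) (c : ℝ) (φ : M → V) : Prop where
  smooth : ∀ ℓ : Module.Dual ℝ V, ContMDiff (𝓡 2) 𝓘(ℝ, ℝ) ∞ (fun p => ℓ (φ p))
  nonconstant : ¬ ∃ v, ∀ p, φ p = v
  eigen : ∀ (ℓ : Module.Dual ℝ V) (p : M), laplacian x (fun q => ℓ (φ q)) p = c * ℓ (φ p)

/-- `φ = φ₁ + ⋯ + φ_k` is a spectral decomposition, with eigenvalues `c₁, …, c_k`. -/
def IsSpectralDecomposition (x : M → E42) (φ : M → V) {k : ℕ} (c : Fin k → ℝ)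
    (ψ : Fin k → M → V) : Prop :=
  0 < k ∧ (∀ i, IsEigenmap x (c i) (ψ i)) ∧ ∀ p, φ p = ∑ i, ψ i p

def IsFiniteType (x : M → E42) (φ : M → V) : Prop :=
  ∃ (k : ℕ) (c : Fin k → ℝ) (ψ : Fin k → M → V), IsSpectralDecomposition x φ c ψ

def IsInfiniteType (x : M → E42) (φ : M → V) : Prop := ¬ IsFiniteType x φ

/-- `φ` is of `k`-type: the eigenvalues are mutually distinct. -/
def IsOfType (x : M → E42) (k : ℕ) (φ : M → V) : Prop :=
  ∃ (c : Fin k → ℝ) (ψ : Fin k → M → V),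
    Function.Injective c ∧ IsSpectralDecomposition x φ c ψ

/-- `φ` is of null `k`-type: moreover one of the eigenvalues is zero. -/
def IsOfNullType (x : M → E42) (k : ℕ) (φ : M → V) : Prop :=
  ∃ (c : Fin k → ℝ) (ψ : Fin k → M → V),
    Function.Injective c ∧ (∃ i, c i = 0) ∧ IsSpectralDecomposition x φ c ψ

/-! ### Complex circles and B-scrolls -/

/-- The complex circle `z₁² + z₂² = κ`, where `ℂ²` with the form `Re (z₁ w₁ + z₂ w₂)` is
identified with `𝔼⁴₂` by `(z₁, z₂) ↦ (Im z₁, Im z₂, Re z₁, Re z₂)`. -/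
def complexCircle (κ : ℂ) : Set E42 :=
  {v | (⟨v 2, v 0⟩ : ℂ) ^ 2 + (⟨v 3, v 1⟩ : ℂ) ^ 2 = κ}

/-- The surface immersed by `x` is the complex circle of radius `κ`. (An injective immersion of
a surface onto the complex circle is a diffeomorphism onto it.) -/
def IsComplexCircle (x : M → E42) (κ : ℂ) : Prop :=
  Function.Injective x ∧ Set.range x = complexCircle κ

/-- `(A, B, C)` is the Cartan frame field along the null curve `γ : I → ℍ³₁`, the first curvature
being `k₁` and the second curvature being the constant `k₂`. -/
structure IsCartanFrame (I : Set ℝ) (γ A B C : ℝ → E42) (k₁ : ℝ → ℝ) (k₂ : ℝ) : Prop where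
  smooth_γ : ContDiffOn ℝ ∞ γ I
  smooth_A : ContDiffOn ℝ ∞ A I
  smooth_B : ContDiffOn ℝ ∞ B I
  smooth_C : ContDiffOn ℝ ∞ C I
  smooth_k₁ : ContDiffOn ℝ ∞ k₁ I
  mem : ∀ s ∈ I, γ s ∈ antiDeSitter
  tangent : ∀ s ∈ I, ip (γ s) (A s) = 0 ∧ ip (γ s) (B s) = 0 ∧ ip (γ s) (C s) = 0
  null : ∀ s ∈ I, ip (A s) (A s) = 0 ∧ ip (B s) (B s) = 0
  pairing : ∀ s ∈ I, ip (A s) (B s) = -1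
  spacelike : ∀ s ∈ I, ip (C s) (C s) = 1 ∧ ip (A s) (C s) = 0 ∧ ip (B s) (C s) = 0
  pos_k₁ : ∀ s ∈ I, 0 < k₁ s
  pos_k₂ : 0 < k₂
  deriv_γ : ∀ s ∈ I, HasDerivAt γ (A s) s
  deriv_A : ∀ s ∈ I, HasDerivAt A (k₁ s • C s) s
  deriv_C : ∀ s ∈ I, HasDerivAt C (k₂ • A s + k₁ s • B s) s
  deriv_B : ∀ s ∈ I, HasDerivAt B (k₂ • C s - γ s) s

/-- The surface immersed by `x` is a B-scroll: up to a diffeomorphism `I × ℝ ≅ M`, with `I` an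
open interval, it is parametrized by `(s, t) ↦ γ(s) + t B(s)`. -/
def IsBScroll (x : M → E42) : Prop :=
  ∃ (I : TopologicalSpace.Opens ℝ) (γ A B C : ℝ → E42) (k₁ : ℝ → ℝ) (k₂ : ℝ)
    (Φ : (I × ℝ) ≃ₘ⟮𝓘(ℝ, ℝ).prod 𝓘(ℝ, ℝ), 𝓡 2⟯ M),
    IsConnected (I : Set ℝ) ∧ IsCartanFrame I γ A B C k₁ k₂ ∧
      ∀ (s : I) (t : ℝ), x (Φ (s, t)) = γ s + t • B s

end Surface

end LorentzSurface

end

/-! Let `N` be a unit normal, `h` the mean curvature and `d = det S`. The Hodge star identifies `⋀³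
𝔼⁴₂` with `𝔼⁴₂` and carries `N` to the Gauss map up to a locally constant sign (`gaussMap_eq`,
`orientSign_eventuallyEq`), so the type of `ν` can be read off from `N`.

The tangential part of `ΔN` is governed by the gradient of the mean curvature, through the Codazzi
equation, and vanishes here. The normal plane spanned by `N` and `x` is then stable: `Δx = -2h N -
2x` and `ΔN = (4h² - 2d) N + 2h x` (`laplacian_position`, `laplacian_normal`). The Gauss equation
gives `d = K + 1`, so the coefficients are constants and the problem concerns one real 2 × 2 matrix,
of trace `4h² - 2d - 2` and determinant `4(d - h²)`. Failure of diagonalizability at one point gives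
`h² ≤ d`, and also makes `a N + b x` non-constant whenever `a ≠ 0`.

On a complex circle, multiplication by `i` preserves the tangent planes and is there an affine
function of `S`; this yields `d = 1`, with `h = 0` exactly when the radius is real
(`trace_det_of_isComplexCircle`). On a B-scroll, `S` is triangular with equal nonzero diagonal
entries in a null basis, so `d = h² ≠ 0` (`trace_det_of_isBScroll`).

If `h = 0`, then `N` is an eigenmap. If `d = h²` and `K ≠ 0`, the matrix has the distinct
eigenvalues `0` and `2K`, and `N` splits into two eigenvectors. If `d = 1` and `h ≠ 0`, the
characteristic polynomial has no real root, or is `T²` when `h² = 1`. In both cases a finite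
spectral decomposition would force `ΔN = 0` (`laplacian_eq_zero_of_finite_sum`), contradicting the
term `2h x` (`isInfiniteType_of_flat`). -/

noncomputable section

namespace LorentzSurface

/-! ### Algebra of the scalar product of index two -/

/-- The scalar product as a continuous bilinear map. -/
def ipL : E42 →L[ℝ] E42 →L[ℝ] ℝ :=
  LinearMap.toContinuousBilinearMap (LinearMap.mk₂ ℝ ip
    (fun _ _ _ => by simp only [ip, Pi.add_apply]; ring)
    (fun _ _ _ => by simp only [ip, Pi.smul_apply, smul_eq_mul]; ring)
    (fun _ _ _ => by simp only [ip, Pi.add_apply]; ring)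
    (fun _ _ _ => by simp only [ip, Pi.smul_apply, smul_eq_mul]; ring))

@[simp] lemma ipL_apply (v w : E42) : ipL v w = ip v w := rfl

lemma ip_comm (v w : E42) : ip v w = ip w v := by simp only [ip]; ring
lemma ip_add_left (u v w : E42) : ip (u + v) w = ip u w + ip v w := by
  simp only [← ipL_apply]; simp
lemma ip_add_right (u v w : E42) : ip u (v + w) = ip u v + ip u w :=
  (ipL u).map_add v w
lemma ip_sub_left (u v w : E42) : ip (u - v) w = ip u w - ip v w := by
  simp only [← ipL_apply]; simp
lemma ip_sub_right (u v w : E42) : ip u (v - w) = ip u v - ip u w :=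
  (ipL u).map_sub v w
lemma ip_neg_left (u v : E42) : ip (-u) v = -ip u v := by
  simp only [← ipL_apply]; simp
lemma ip_neg_right (u v : E42) : ip u (-v) = -ip u v :=
  (ipL u).map_neg v
lemma ip_smul_left (c : ℝ) (u v : E42) : ip (c • u) v = c * ip u v := by
  simp only [← ipL_apply]; simp
lemma ip_smul_right (c : ℝ) (u v : E42) : ip u (c • v) = c * ip u v :=
  (ipL u).map_smul c v
lemma ip_zero_left (u : E42) : ip 0 u = 0 := by simp only [← ipL_apply]; simp

/-- Gram determinants: `det (⟨aᵢ, aⱼ⟩) = (det a)²`. -/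
lemma det_gram (a : Fin 4 → E42) :
    (Matrix.of fun i j => ip (a i) (a j)).det = (Matrix.of a).det ^ 2 := by
  have h : (Matrix.of fun i j => ip (a i) (a j))
      = Matrix.of a * Matrix.diagonal ![-1, -1, 1, 1] * (Matrix.of a).transpose := by
    ext i j
    rw [Matrix.mul_apply]
    simp only [Matrix.mul_diagonal, Fin.sum_univ_four, Matrix.transpose_apply,
      Matrix.of_apply, ip, Matrix.cons_val]
    ring
  rw [h, Matrix.det_mul, Matrix.det_mul, Matrix.det_transpose, Matrix.det_diagonal,
    Fin.prod_univ_four]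
  simp only [Matrix.cons_val]
  ring

/-- The Gram determinant of a frame adapted to a surface in anti-de Sitter space. -/
lemma det_sq_of_adapted {y n a b : E42} (hy : ip y y = -1) (hn : ip n n = 1) (hny : ip n y = 0)
    (hna : ip n a = 0) (hnb : ip n b = 0) (hya : ip y a = 0) (hyb : ip y b = 0) :
    (Matrix.of ![n, y, a, b]).det ^ 2 = -(ip a a * ip b b - ip a b ^ 2) := by
  rw [← det_gram]
  simp [Matrix.det_succ_row_zero, Fin.sum_univ_succ, hy, hn, hny, hna, hnb, hya, hyb,
    ip_comm y n, ip_comm a n, ip_comm b n, ip_comm a y, ip_comm b y, ip_comm b a, Fin.succAbove]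
  ring

/-- Up to the signs of the form, the pairings with the `a i` are the product of an invertible matrix
with `w`. -/
lemma eq_zero_of_ip_eq_zero {a : Fin 4 → E42} (ha : (Matrix.of a).det ≠ 0) {w : E42}
    (hw : ∀ i, ip (a i) w = 0) : w = 0 := by
  have h : (Matrix.of a).mulVec (fun i => ![-1, -1, 1, 1] i * w i) = 0 := by
    ext i
    have := hw i
    simp only [ip] at this
    simp only [Matrix.mulVec, dotProduct, Fin.sum_univ_four, Matrix.of_apply, Matrix.cons_val,
      Pi.zero_apply]
    linarith
  have h' := Matrix.eq_zero_of_mulVec_eq_zero ha h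
  ext i
  have := congrFun h' i
  fin_cases i <;> simpa using this

/-- A vector orthogonal to an adapted frame vanishes. -/
lemma eq_zero_of_adapted {y n a b w : E42} (hy : ip y y = -1) (hn : ip n n = 1) (hny : ip n y = 0)
    (hna : ip n a = 0) (hnb : ip n b = 0) (hya : ip y a = 0) (hyb : ip y b = 0)
    (hd : ip a a * ip b b - ip a b ^ 2 ≠ 0)
    (hw : ip w n = 0) (hw' : ip w y = 0) (hwa : ip w a = 0) (hwb : ip w b = 0) : w = 0 := by
  have hdet : (Matrix.of ![n, y, a, b]).det ≠ 0 := by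
    intro h
    have := det_sq_of_adapted hy hn hny hna hnb hya hyb
    rw [h] at this
    apply hd
    linarith
  refine eq_zero_of_ip_eq_zero hdet fun i => ?_
  rw [ip_comm]
  fin_cases i <;> simpa

/-! ### The ternary vector product and the Hodge star operator -/

/-- The ternary vector product on `𝔼⁴₂`: `⟨cross ![a, b, c], w⟩ = det (w, a, b, c)`. -/
def cross : E42 [⋀^Fin 3]→ₗ[ℝ] E42 :=
  AlternatingMap.pi fun i => (![-1, -1, 1, 1] i : ℝ) •
    (Matrix.detRowAlternating (R := ℝ) (n := Fin 4)).curryLeft (Pi.single i 1)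

lemma cross_apply (v : Fin 3 → E42) (i : Fin 4) :
    cross v i = ![-1, -1, 1, 1] i * (Matrix.of (Matrix.vecCons (Pi.single i 1) v)).det := by
  simp only [cross, AlternatingMap.pi_apply, AlternatingMap.smul_apply, smul_eq_mul]
  rfl

/-- Linearity of the determinant in its first row; the signs built into `cross` cancel those of
`ip`. -/
lemma ip_cross (v : Fin 3 → E42) (w : E42) :
    ip (cross v) w = (Matrix.of (Matrix.vecCons w v)).det := by
  have h : (Matrix.of (Matrix.vecCons w v)).det
      = ∑ i, w i * (Matrix.of (Matrix.vecCons (Pi.single i 1) v)).det := by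
    have h1 : w = ∑ i, w i • (Pi.single i (1 : ℝ) : E42) := pi_eq_sum_univ' w
    have h2 : ∀ u : E42, (Matrix.of (Matrix.vecCons u v)).det
      = (Matrix.detRowAlternating (R := ℝ) (n := Fin 4)).curryLeftLinearMap u v := fun u => rfl
    simp only [h2]
    conv_lhs => rw [h1]
    rw [Fin.sum_univ_four, Fin.sum_univ_four]
    simp only [map_add, map_smul, AlternatingMap.add_apply, AlternatingMap.smul_apply, smul_eq_mul]
  rw [h, Fin.sum_univ_four]
  simp only [ip, cross_apply, Matrix.cons_val]
  ring

/-- The linear map `⋀³ 𝔼⁴₂ → 𝔼⁴₂` induced by the ternary vector product. -/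
def crossLift : ⋀[ℝ]^3 E42 →ₗ[ℝ] E42 := exteriorPower.alternatingMapLinearEquiv cross

lemma crossLift_ιMulti (v : Fin 3 → E42) :
    crossLift (exteriorPower.ιMulti ℝ 3 v) = cross v := by
  simp [crossLift]

/-- The product of three standard basis vectors is, up to sign, the remaining one. As both spaces
have dimension 4, this suffices for bijectivity. -/
lemma crossLift_surjective : Function.Surjective crossLift := by
  have hr : ∀ v, cross v ∈ LinearMap.range crossLift := fun v => ⟨_, crossLift_ιMulti v⟩
  have key : ∀ i : Fin 4, (Pi.single i (1 : ℝ) : E42) ∈ LinearMap.range crossLift := by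
    intro i
    have h : ∃ v, cross v = Pi.single i (1 : ℝ) ∨ cross v = -Pi.single i (1 : ℝ) := by
      refine ⟨fun j => Pi.single (i.succAbove j) 1, ?_⟩
      fin_cases i
      · right; ext j
        fin_cases j <;>
          simp [cross_apply, Matrix.det_succ_row_zero, Fin.sum_univ_succ, Fin.succAbove, Pi.single_apply]
      · left; ext j
        fin_cases j <;>
          simp [cross_apply, Matrix.det_succ_row_zero, Fin.sum_univ_succ, Fin.succAbove, Pi.single_apply]
      · left; ext j
        fin_cases j <;>
          simp [cross_apply, Matrix.det_succ_row_zero, Fin.sum_univ_succ, Fin.succAbove, Pi.single_apply]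
      · right; ext j
        fin_cases j <;>
          simp [cross_apply, Matrix.det_succ_row_zero, Fin.sum_univ_succ, Fin.succAbove, Pi.single_apply]; norm_num
    obtain ⟨v, hv | hv⟩ := h
    · exact hv ▸ hr v
    · have := neg_mem (hr v)
      rwa [hv, neg_neg] at this
  intro w
  change w ∈ LinearMap.range crossLift
  rw [pi_eq_sum_univ' w]
  exact Submodule.sum_mem _ fun i _ => Submodule.smul_mem _ _ (key i)

/-- The Hodge star operator `𝔼⁴₂ ≃ ⋀³ 𝔼⁴₂`. -/
def hodgeStar : E42 ≃ₗ[ℝ] ⋀[ℝ]^3 E42 :=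
  (LinearEquiv.ofBijective crossLift
    ⟨(LinearMap.injective_iff_surjective_of_finrank_eq_finrank (by
      rw [exteriorPower.finrank_eq]; simp)).2 crossLift_surjective,
      crossLift_surjective⟩).symm

lemma ιMulti_eq_hodgeStar (v : Fin 3 → E42) : exteriorPower.ιMulti ℝ 3 v = hodgeStar (cross v) := by
  rw [hodgeStar, LinearEquiv.eq_symm_apply]
  exact crossLift_ιMulti v

/-! ### Partial derivatives in the coordinate plane -/

section PartialDerivatives

variable {F : Type*} [NormedAddCommGroup F] [NormedSpace ℝ F]

lemma pd_congr {f g : Plane → F} {u : Plane} (h : f =ᶠ[nhds u] g) (i : Fin 2) :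
    pd i f u = pd i g u := by
  rw [pd, pd, h.fderiv_eq]

lemma pd_eventuallyEq {f g : Plane → F} {u : Plane} (h : f =ᶠ[nhds u] g) (i : Fin 2) :
    pd i f =ᶠ[nhds u] pd i g := by
  filter_upwards [h.eventuallyEq_nhds] with v hv using pd_congr hv i

lemma pd_const (c : F) (i : Fin 2) (u : Plane) : pd i (fun _ => c) u = 0 := by
  simp [pd]

lemma pd_add {f g : Plane → F} {u : Plane} (hf : DifferentiableAt ℝ f u)
    (hg : DifferentiableAt ℝ g u) (i : Fin 2) :
    pd i (fun v => f v + g v) u = pd i f u + pd i g u := by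
  simp only [pd]
  rw [fderiv_fun_add hf hg]
  rfl

lemma pd_sub {f g : Plane → F} {u : Plane} (hf : DifferentiableAt ℝ f u)
    (hg : DifferentiableAt ℝ g u) (i : Fin 2) :
    pd i (fun v => f v - g v) u = pd i f u - pd i g u := by
  simp only [pd]
  rw [fderiv_fun_sub hf hg]
  rfl

lemma pd_const_smul {f : Plane → F} {u : Plane} (c : ℝ) (hf : DifferentiableAt ℝ f u)
    (i : Fin 2) : pd i (fun v => c • f v) u = c • pd i f u := by
  simp only [pd]
  rw [fderiv_fun_const_smul hf]
  rfl

lemma pd_smul {c : Plane → ℝ} {f : Plane → F} {u : Plane} (hc : DifferentiableAt ℝ c u)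
    (hf : DifferentiableAt ℝ f u) (i : Fin 2) :
    pd i (fun v => c v • f v) u = pd i c u • f u + c u • pd i f u := by
  simp only [pd]
  rw [fderiv_fun_smul hc hf]
  simp [add_comm]

lemma pd_mul {c f : Plane → ℝ} {u : Plane} (hc : DifferentiableAt ℝ c u)
    (hf : DifferentiableAt ℝ f u) (i : Fin 2) :
    pd i (fun v => c v * f v) u = pd i c u * f u + c u * pd i f u :=
  pd_smul hc hf i

lemma pd_clm {G : Type*} [NormedAddCommGroup G] [NormedSpace ℝ G] (l : F →L[ℝ] G)
    {f : Plane → F} {u : Plane} (hf : DifferentiableAt ℝ f u) (i : Fin 2) :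
    pd i (fun v => l (f v)) u = l (pd i f u) := by
  have h := (l.hasFDerivAt.comp u hf.hasFDerivAt).fderiv
  simp only [pd]
  change fderiv ℝ (l ∘ f) u _ = _
  rw [h]
  rfl

lemma pd_ip {a b : Plane → E42} {u : Plane} (ha : DifferentiableAt ℝ a u)
    (hb : DifferentiableAt ℝ b u) (i : Fin 2) :
    pd i (fun v => ip (a v) (b v)) u = ip (pd i a u) (b u) + ip (a u) (pd i b u) := by
  have h := (ipL.hasFDerivAt_of_bilinear ha.hasFDerivAt hb.hasFDerivAt).fderiv
  simp only [pd]
  change fderiv ℝ (fun v => ipL (a v) (b v)) u _ = _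
  rw [h]
  simp [add_comm]

lemma contDiffOn_pd {f : Plane → F} {U : Set Plane} (hU : IsOpen U) (hf : ContDiffOn ℝ ∞ f U)
    (i : Fin 2) : ContDiffOn ℝ ∞ (pd i f) U :=
  (hf.fderiv_of_isOpen hU (by simp)).clm_apply contDiffOn_const

lemma contDiffOn_ip {a b : Plane → E42} {U : Set Plane} (ha : ContDiffOn ℝ ∞ a U)
    (hb : ContDiffOn ℝ ∞ b U) : ContDiffOn ℝ ∞ (fun v => ip (a v) (b v)) U :=
  (ipL.contDiff.comp_contDiffOn ha).clm_apply hb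

lemma differentiableAt_of_contDiffOn {f : Plane → F} {U : Set Plane} (hU : IsOpen U)
    (hf : ContDiffOn ℝ ∞ f U) {u : Plane} (hu : u ∈ U) : DifferentiableAt ℝ f u :=
  (hf.contDiffAt (hU.mem_nhds hu)).differentiableAt (by simp)

lemma pd_comm {f : Plane → F} {U : Set Plane} (hU : IsOpen U) (hf : ContDiffOn ℝ ∞ f U)
    {u : Plane} (hu : u ∈ U) (i j : Fin 2) : pd i (pd j f) u = pd j (pd i f) u := by
  have hd : DifferentiableAt ℝ (fderiv ℝ f) u :=
    differentiableAt_of_contDiffOn hU (hf.fderiv_of_isOpen hU (by simp)) hu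
  have h (a b : Fin 2) : pd a (pd b f) u
      = fderiv ℝ (fderiv ℝ f) u (EuclideanSpace.single a 1) (EuclideanSpace.single b 1) := by
    have : pd b f = fun v => (fderiv ℝ f v) (EuclideanSpace.single b 1) := rfl
    rw [this, pd, fderiv_clm_apply hd (differentiableAt_const _)]
    simp
  rw [h, h]
  exact ((hf.contDiffAt (hU.mem_nhds hu)).isSymmSndFDerivAt (by simpa using WithTop.coe_le_coe.2 (le_top (a := (2 : ℕ∞))))) _ _

end PartialDerivatives

/-! ### Surfaces in a coordinate chart -/

/-- First fundamental form of a parametrized surface. -/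
def coordMetric (y : Plane → E42) (u : Plane) : Matrix (Fin 2) (Fin 2) ℝ :=
  Matrix.of fun i j => ip (pd i y u) (pd j y u)

lemma coordMetric_apply (y : Plane → E42) (u : Plane) (i j : Fin 2) :
    coordMetric y u i j = ip (pd i y u) (pd j y u) := rfl

lemma coordMetric_symm (y : Plane → E42) (u : Plane) (i j : Fin 2) :
    coordMetric y u i j = coordMetric y u j i := ip_comm _ _

lemma det_coordMetric (y : Plane → E42) (u : Plane) :
    (coordMetric y u).det
      = coordMetric y u 0 0 * coordMetric y u 1 1 - coordMetric y u 0 1 ^ 2 := by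
  rw [Matrix.det_fin_two, coordMetric_symm y u 1 0]; ring

/-- Second fundamental form with respect to the normal field `n`. -/
def secondForm (y n : Plane → E42) (i j : Fin 2) (u : Plane) : ℝ := ip (n u) (pd i (pd j y) u)

/-- Laplacian of a map into `𝔼⁴₂`. -/
def vecLaplacian (g : Plane → Matrix (Fin 2) (Fin 2) ℝ) (z : Plane → E42) (u : Plane) : E42 :=
  -∑ i, ∑ j, (g u)⁻¹ i j • (pd i (pd j z) u - ∑ k, christoffel g k i j u • pd k z u)

/-- A surface in anti-de Sitter space parametrized by an open set of the plane, with nondegenerate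
metric, together with a unit normal field. -/
structure IsCoordSurface (U : Set Plane) (y n : Plane → E42) : Prop where
  isOpen : IsOpen U
  smooth : ContDiffOn ℝ ∞ y U
  smooth_normal : ContDiffOn ℝ ∞ n U
  mem : ∀ u ∈ U, ip (y u) (y u) = -1
  unit : ∀ u ∈ U, ip (n u) (n u) = 1
  tangent : ∀ u ∈ U, ip (n u) (y u) = 0
  normal : ∀ u ∈ U, ∀ i, ip (n u) (pd i y u) = 0
  nondeg : ∀ u ∈ U, (coordMetric y u).det ≠ 0

namespace IsCoordSurface

variable {U : Set Plane} {y n : Plane → E42} (h : IsCoordSurface U y n) {u : Plane} (hu : u ∈ U)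

include h hu

lemma diffAt_y : DifferentiableAt ℝ y u := differentiableAt_of_contDiffOn h.isOpen h.smooth hu

lemma diffAt_n : DifferentiableAt ℝ n u :=
  differentiableAt_of_contDiffOn h.isOpen h.smooth_normal hu

lemma diffAt_pd_y (i : Fin 2) : DifferentiableAt ℝ (pd i y) u :=
  differentiableAt_of_contDiffOn h.isOpen (contDiffOn_pd h.isOpen h.smooth i) hu

lemma diffAt_pd_n (i : Fin 2) : DifferentiableAt ℝ (pd i n) u :=
  differentiableAt_of_contDiffOn h.isOpen (contDiffOn_pd h.isOpen h.smooth_normal i) hu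

lemma eventually_mem : ∀ᶠ v in nhds u, v ∈ U := h.isOpen.mem_nhds hu

lemma ip_y_pd (i : Fin 2) : ip (y u) (pd i y u) = 0 := by
  have h1 : (fun v => ip (y v) (y v)) =ᶠ[nhds u] fun _ => -1 := by
    filter_upwards [h.eventually_mem hu] with v hv using h.mem v hv
  have h2 := pd_congr h1 i
  rw [pd_ip (h.diffAt_y hu) (h.diffAt_y hu), pd_const, ip_comm] at h2
  linarith

lemma ip_pd_y_y (i : Fin 2) : ip (pd i y u) (y u) = 0 := by rw [ip_comm, h.ip_y_pd hu]

lemma ip_y_n : ip (y u) (n u) = 0 := by rw [ip_comm, h.tangent u hu]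

lemma ip_pd_y_n (i : Fin 2) : ip (pd i y u) (n u) = 0 := by rw [ip_comm, h.normal u hu]

omit h hu in
lemma ip_pd_pd_y_n (i j : Fin 2) : ip (pd i (pd j y) u) (n u) = secondForm y n i j u :=
  ip_comm _ _

lemma ip_pd_n_n (i : Fin 2) : ip (pd i n u) (n u) = 0 := by
  have h1 : (fun v => ip (n v) (n v)) =ᶠ[nhds u] fun _ => 1 := by
    filter_upwards [h.eventually_mem hu] with v hv using h.unit v hv
  have h2 := pd_congr h1 i
  rw [pd_ip (h.diffAt_n hu) (h.diffAt_n hu), pd_const, ip_comm (n u)] at h2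
  linarith

lemma ip_pd_n_y (i : Fin 2) : ip (pd i n u) (y u) = 0 := by
  have h1 : (fun v => ip (n v) (y v)) =ᶠ[nhds u] fun _ => 0 := by
    filter_upwards [h.eventually_mem hu] with v hv using h.tangent v hv
  have h2 := pd_congr h1 i
  rw [pd_ip (h.diffAt_n hu) (h.diffAt_y hu), pd_const, h.normal u hu] at h2
  linarith

lemma ip_pd_n_pd_y (i j : Fin 2) : ip (pd i n u) (pd j y u) = -secondForm y n i j u := by
  have h1 : (fun v => ip (n v) (pd j y v)) =ᶠ[nhds u] fun _ => 0 := by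
    filter_upwards [h.eventually_mem hu] with v hv using h.normal v hv j
  have h2 := pd_congr h1 i
  rw [pd_ip (h.diffAt_n hu) (h.diffAt_pd_y hu j), pd_const] at h2
  rw [secondForm]
  linarith

lemma secondForm_symm (i j : Fin 2) : secondForm y n i j u = secondForm y n j i u := by
  rw [secondForm, secondForm, pd_comm h.isOpen h.smooth hu]

lemma ip_pd_pd_y_y (i j : Fin 2) : ip (pd i (pd j y) u) (y u) = -coordMetric y u i j := by
  have h1 : (fun v => ip (y v) (pd j y v)) =ᶠ[nhds u] fun _ => 0 := by
    filter_upwards [h.eventually_mem hu] with v hv using h.ip_y_pd hv j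
  have h2 := pd_congr h1 i
  rw [pd_ip (h.diffAt_y hu) (h.diffAt_pd_y hu j), pd_const, ip_comm (y u)] at h2
  rw [coordMetric_apply]
  linarith

lemma eq_zero {w : E42} (hn : ip w (n u) = 0) (hy : ip w (y u) = 0)
    (hd : ∀ i, ip w (pd i y u) = 0) : w = 0 := by
  have := h.nondeg u hu
  rw [det_coordMetric] at this
  exact eq_zero_of_adapted (h.mem u hu) (h.unit u hu) (h.tangent u hu) (h.normal u hu 0)
    (h.normal u hu 1) (h.ip_y_pd hu 0) (h.ip_y_pd hu 1) this hn hy (hd 0) (hd 1)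

omit h hu in
lemma coordMetric_inv (hd : (coordMetric y u).det ≠ 0) :
    (coordMetric y u)⁻¹ 0 0 = coordMetric y u 1 1 / (coordMetric y u).det ∧
    (coordMetric y u)⁻¹ 0 1 = -coordMetric y u 0 1 / (coordMetric y u).det ∧
    (coordMetric y u)⁻¹ 1 0 = -coordMetric y u 0 1 / (coordMetric y u).det ∧
    (coordMetric y u)⁻¹ 1 1 = coordMetric y u 0 0 / (coordMetric y u).det := by
  simp only [Matrix.inv_def, Matrix.adjugate_fin_two, Ring.inverse_eq_inv', Matrix.smul_apply,
    Matrix.of_apply, Matrix.cons_val', Matrix.cons_val, smul_eq_mul, coordMetric_symm y u 1 0]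
  refine ⟨?_, ?_, ?_, ?_⟩ <;> field_simp

lemma pd_coordMetric (i j l : Fin 2) :
    pd i (fun v => coordMetric y v j l) u
      = ip (pd i (pd j y) u) (pd l y u) + ip (pd i (pd l y) u) (pd j y u) := by
  simp only [coordMetric_apply]
  rw [pd_ip (h.diffAt_pd_y hu j) (h.diffAt_pd_y hu l), ip_comm (pd j y u)]

/-- The Christoffel symbols are the tangential components of the second derivatives. -/
lemma christoffel_eq (k i j : Fin 2) :
    christoffel (coordMetric y) k i j u
      = ∑ l, (coordMetric y u)⁻¹ k l * ip (pd i (pd j y) u) (pd l y u) := by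
  have hc (a b : Fin 2) := pd_comm h.isOpen h.smooth hu a b
  simp only [christoffel, h.pd_coordMetric hu, Finset.mul_sum]
  refine Finset.sum_congr rfl fun l _ => ?_
  rw [hc j i, hc i l, hc j l]
  ring

lemma christoffel_symm (k i j : Fin 2) :
    christoffel (coordMetric y) k i j u = christoffel (coordMetric y) k j i u := by
  rw [h.christoffel_eq hu, h.christoffel_eq hu, pd_comm h.isOpen h.smooth hu]

/-- The index raised in `christoffel_eq` is lowered again, so that Christoffel symbols can be
eliminated in favour of scalar products. -/
lemma sum_christoffel_mul (i j l : Fin 2) :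
    ∑ k, christoffel (coordMetric y) k i j u * coordMetric y u k l
      = ip (pd i (pd j y) u) (pd l y u) := by
  have hd := h.nondeg u hu
  simp only [h.christoffel_eq hu]
  obtain ⟨h00, h01, h10, h11⟩ := coordMetric_inv hd
  simp only [Fin.sum_univ_two, h00, h01, h10, h11]
  have hs := coordMetric_symm y u 1 0
  have hdet := det_coordMetric y u
  fin_cases l
  · simp only [Fin.zero_eta, hs]
    field_simp
    rw [hdet]; ring
  · simp only [Fin.mk_one]
    field_simp
    rw [hdet]; ring

/-- The Gauss formula. -/
lemma pd_pd_y (i j : Fin 2) :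
    pd i (pd j y) u = ∑ k, christoffel (coordMetric y) k i j u • pd k y u
      + secondForm y n i j u • n u + coordMetric y u i j • y u := by
  rw [← sub_eq_zero]
  -- `n`, `y`, `∂₀y`, `∂₁y` form a frame of `𝔼⁴₂`, so it is enough to compare the pairings with
  -- these four vectors.
  apply h.eq_zero hu
  · simp only [ip_sub_left, ip_add_left, ip_smul_left, Fin.sum_univ_two, h.unit u hu,
      h.ip_pd_y_n hu, h.ip_y_n hu, ip_pd_pd_y_n]
    ring
  · simp only [ip_sub_left, ip_add_left, ip_smul_left, Fin.sum_univ_two, h.mem u hu,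
      h.ip_pd_y_y hu, h.tangent u hu, h.ip_pd_pd_y_y hu]
    ring
  · intro l
    simp only [ip_sub_left, ip_add_left, ip_smul_left, Fin.sum_univ_two, h.normal u hu,
      h.ip_y_pd hu, ← h.sum_christoffel_mul hu, coordMetric_apply]
    ring

/-- `∂ₘn` is tangent to the surface, so only the tangential part of the Gauss formula contributes.
-/
lemma ip_pd_n_pd_pd_y (m i j : Fin 2) :
    ip (pd m n u) (pd i (pd j y) u)
      = -∑ k, christoffel (coordMetric y) k i j u * secondForm y n m k u := by
  rw [h.pd_pd_y hu i j]
  simp only [ip_add_right, ip_smul_right, Fin.sum_univ_two, h.ip_pd_n_pd_y hu, h.ip_pd_n_n hu,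
    h.ip_pd_n_y hu]
  ring

/-- The Weingarten formula. -/
lemma pd_n (i : Fin 2) :
    pd i n u
      = -∑ k, (∑ l, (coordMetric y u)⁻¹ k l * secondForm y n i l u) • pd k y u := by
  have hd := h.nondeg u hu
  rw [← sub_eq_zero]
  apply h.eq_zero hu
  · simp only [ip_sub_left, ip_neg_left, ip_add_left, ip_smul_left, Fin.sum_univ_two,
      h.ip_pd_y_n hu, h.ip_pd_n_n hu]
    ring
  · simp only [ip_sub_left, ip_neg_left, ip_add_left, ip_smul_left, Fin.sum_univ_two,
      h.ip_pd_y_y hu, h.ip_pd_n_y hu]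
    ring
  · intro l
    obtain ⟨h00, h01, h10, h11⟩ := coordMetric_inv hd
    simp only [ip_sub_left, ip_neg_left, ip_add_left, ip_smul_left, Fin.sum_univ_two,
      h.ip_pd_n_pd_y hu, ← coordMetric_apply, h00, h01, h10, h11]
    have hs := coordMetric_symm y u 1 0
    have hdet := det_coordMetric y u
    fin_cases l
    · simp only [Fin.zero_eta, hs]
      field_simp
      rw [hdet]; ring
    · simp only [Fin.mk_one]
      field_simp
      rw [hdet]; ring

end IsCoordSurface

/-- Contracted Codazzi equation, as an identity between the components at a point of the
second derivatives `q` of the normal field, the second fundamental form `b`, the metric `g`, the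
Christoffel symbols `Γ` and the derivatives `dg`, `db` of `g`, `b`; `H` is the trace of `b`,
assumed stationary. -/
lemma contracted_codazzi {g b : Fin 2 → Fin 2 → ℝ} {Γ q dg db : Fin 2 → Fin 2 → Fin 2 → ℝ}
    {H : ℝ} (hg : g 1 0 = g 0 1) (hb : b 1 0 = b 0 1) (hΓ : ∀ k, Γ k 1 0 = Γ k 0 1)
    (hq : ∀ l, q 1 0 l = q 0 1 l)
    (hdb : ∀ i j l, db i j l = -q i j l + ∑ k, Γ k i l * b j k)
    (hdb' : ∀ i, db i 1 0 = db i 0 1)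
    (hdg : ∀ i j l, dg i j l = ∑ k, Γ k i j * g k l + ∑ k, Γ k i l * g k j)
    (htr : g 1 1 * b 0 0 - 2 * g 0 1 * b 0 1 + g 0 0 * b 1 1 = H * (g 0 0 * g 1 1 - g 0 1 ^ 2))
    (hdtr : ∀ i, dg i 1 1 * b 0 0 + g 1 1 * db i 0 0 - 2 * (dg i 0 1 * b 0 1 + g 0 1 * db i 0 1)
      + (dg i 0 0 * b 1 1 + g 0 0 * db i 1 1)
      = H * (dg i 0 0 * g 1 1 + g 0 0 * dg i 1 1 - 2 * (g 0 1 * dg i 0 1))) (l : Fin 2) :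
    g 1 1 * (q 0 0 l + ∑ k, Γ k 0 0 * b k l) - 2 * g 0 1 * (q 0 1 l + ∑ k, Γ k 0 1 * b k l)
      + g 0 0 * (q 1 1 l + ∑ k, Γ k 1 1 * b k l) = 0 := by
  -- `e0` and `e1` say that the trace is stationary. `c0` and `c1`, which express the symmetry of
  -- the derivatives of `b`, are the two Codazzi equations.
  have e0 := hdtr 0
  have e1 := hdtr 1
  have c0 := hdb' 0
  have c1 := hdb' 1
  simp only [hdb, hdg, Fin.sum_univ_two, hg, hb, hΓ, hq] at e0 e1 c0 c1 ⊢
  fin_cases l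
  · simp only [Fin.zero_eta, hb]
    linear_combination -e0 + 2 * (Γ 0 0 0 + Γ 1 0 1) * htr + 2 * g 0 1 * c0 - g 0 0 * c1
  · simp only [Fin.mk_one]
    linear_combination -e1 + 2 * (Γ 0 0 1 + Γ 1 1 1) * htr + g 1 1 * c0

/-! ### Laplacians of the position vector and the normal; the Gauss equation -/

namespace IsCoordSurface

variable {U : Set Plane} {y n : Plane → E42} (h : IsCoordSurface U y n) {u : Plane} (hu : u ∈ U)

include h hu

/-- The Laplacian of the position vector. -/
lemma vecLaplacian_y {H : ℝ}
    (hH : ∑ i, ∑ j, (coordMetric y u)⁻¹ i j * secondForm y n i j u = H) :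
    vecLaplacian (coordMetric y) y u = -H • n u - (2 : ℝ) • y u := by
  have hd := h.nondeg u hu
  obtain ⟨h00, h01, h10, h11⟩ := coordMetric_inv hd
  have ht : ∑ i, ∑ j, (coordMetric y u)⁻¹ i j * coordMetric y u i j = 2 := by
    simp only [Fin.sum_univ_two, h00, h01, h10, h11, coordMetric_symm y u 1 0]
    field_simp
    rw [det_coordMetric]; ring
  have h1 (i j) : pd i (pd j y) u - ∑ k, christoffel (coordMetric y) k i j u • pd k y u
      = secondForm y n i j u • n u + coordMetric y u i j • y u := by
    rw [h.pd_pd_y hu i j]; abel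
  rw [vecLaplacian, ← hH, ← ht]
  simp only [h1]
  simp only [Fin.sum_univ_two]
  module

lemma ip_pd_pd_n_n (i j : Fin 2) : ip (pd i (pd j n) u) (n u) = -ip (pd i n u) (pd j n u) := by
  have h1 : (fun v => ip (pd j n v) (n v)) =ᶠ[nhds u] fun _ => 0 := by
    filter_upwards [h.eventually_mem hu] with v hv using h.ip_pd_n_n hv j
  have h2 := pd_congr h1 i
  rw [pd_ip (h.diffAt_pd_n hu j) (h.diffAt_n hu), pd_const, ip_comm (pd j n u)] at h2
  linarith

lemma ip_pd_pd_n_y (i j : Fin 2) : ip (pd i (pd j n) u) (y u) = secondForm y n i j u := by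
  have h1 : (fun v => ip (pd j n v) (y v)) =ᶠ[nhds u] fun _ => 0 := by
    filter_upwards [h.eventually_mem hu] with v hv using h.ip_pd_n_y hv j
  have h2 := pd_congr h1 i
  rw [pd_ip (h.diffAt_pd_n hu j) (h.diffAt_y hu), pd_const, h.ip_pd_n_pd_y hu] at h2
  rw [h.secondForm_symm hu]
  linarith

/-- Differentiating `-⟨∂ⱼn, ∂ₗy⟩` instead of `⟨n, ∂ⱼ∂ₗy⟩` avoids third derivatives of `y` and brings
in the second derivatives of `n` that occur in its Laplacian. -/
lemma pd_secondForm (i j l : Fin 2) :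
    pd i (secondForm y n j l) u = -ip (pd i (pd j n) u) (pd l y u)
      + ∑ k, christoffel (coordMetric y) k i l u * secondForm y n j k u := by
  have h1 : secondForm y n j l =ᶠ[nhds u] fun v => (-1 : ℝ) • ip (pd j n v) (pd l y v) := by
    filter_upwards [h.eventually_mem hu] with v hv
    rw [h.ip_pd_n_pd_y hv]
    simp
  have hd : DifferentiableAt ℝ (fun v => ip (pd j n v) (pd l y v)) u :=
    differentiableAt_of_contDiffOn h.isOpen
      (contDiffOn_ip (contDiffOn_pd h.isOpen h.smooth_normal j)
        (contDiffOn_pd h.isOpen h.smooth l)) hu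
  rw [pd_congr h1, pd_const_smul _ hd, pd_ip (h.diffAt_pd_n hu j) (h.diffAt_pd_y hu l),
    h.ip_pd_n_pd_pd_y hu]
  simp
  ring

lemma diffAt_secondForm (i j : Fin 2) : DifferentiableAt ℝ (secondForm y n i j) u :=
  differentiableAt_of_contDiffOn h.isOpen (contDiffOn_ip h.smooth_normal
    (contDiffOn_pd h.isOpen (contDiffOn_pd h.isOpen h.smooth j) i)) hu

lemma diffAt_coordMetric (i j : Fin 2) : DifferentiableAt ℝ (fun v => coordMetric y v i j) u :=
  differentiableAt_of_contDiffOn h.isOpen (contDiffOn_ip (contDiffOn_pd h.isOpen h.smooth i)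
    (contDiffOn_pd h.isOpen h.smooth j)) hu

lemma trace_mul_det {H : ℝ}
    (hH : ∑ i, ∑ j, (coordMetric y u)⁻¹ i j * secondForm y n i j u = H) :
    coordMetric y u 1 1 * secondForm y n 0 0 u - 2 * coordMetric y u 0 1 * secondForm y n 0 1 u
      + coordMetric y u 0 0 * secondForm y n 1 1 u
      = H * (coordMetric y u 0 0 * coordMetric y u 1 1 - coordMetric y u 0 1 ^ 2) := by
  have hd := h.nondeg u hu
  obtain ⟨h00, h01, h10, h11⟩ := coordMetric_inv hd
  rw [← hH, ← det_coordMetric]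
  simp only [Fin.sum_univ_two, h00, h01, h10, h11, h.secondForm_symm hu 1 0]
  field_simp
  ring

/-- By the contracted Codazzi equation the tangential part of the Laplacian of `n` is determined by
the derivative of the trace `H`, which is constant. -/
lemma ip_vecLaplacian_n_pd {H : ℝ}
    (hH : ∀ v ∈ U, ∑ i, ∑ j, (coordMetric y v)⁻¹ i j * secondForm y n i j v = H) (l : Fin 2) :
    ip (vecLaplacian (coordMetric y) n u) (pd l y u) = 0 := by
  have hd := h.nondeg u hu
  obtain ⟨h00, h01, h10, h11⟩ := coordMetric_inv hd
  have key := contracted_codazzi (g := fun i j => coordMetric y u i j)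
    (b := fun i j => secondForm y n i j u)
    (Γ := fun k i j => christoffel (coordMetric y) k i j u)
    (q := fun i j l => ip (pd i (pd j n) u) (pd l y u))
    (dg := fun i j l => pd i (fun v => coordMetric y v j l) u)
    (db := fun i j l => pd i (secondForm y n j l) u)
    (H := H) (coordMetric_symm y u 1 0) (h.secondForm_symm hu 1 0)
    (fun k => h.christoffel_symm hu k 1 0)
    (fun l => by rw [pd_comm h.isOpen h.smooth_normal hu])
    (fun i j l => h.pd_secondForm hu i j l)
    (fun i => pd_congr (by
      filter_upwards [h.eventually_mem hu] with v hv using h.secondForm_symm hv 1 0) i)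
    (fun i j l => by
      rw [h.pd_coordMetric hu, h.sum_christoffel_mul hu, h.sum_christoffel_mul hu])
    (h.trace_mul_det hu (hH u hu))
    -- Stationarity of the trace comes from differentiating its denominator-free form
    -- `trace_mul_det`.
    (fun i => by
      have e : (fun v => coordMetric y v 1 1 * secondForm y n 0 0 v
          - (2 : ℝ) • (coordMetric y v 0 1 * secondForm y n 0 1 v)
          + coordMetric y v 0 0 * secondForm y n 1 1 v)
          =ᶠ[nhds u] fun v => H • (coordMetric y v 0 0 * coordMetric y v 1 1
            - coordMetric y v 0 1 * coordMetric y v 0 1) := by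
        filter_upwards [h.eventually_mem hu] with v hv
        have := h.trace_mul_det hv (hH v hv)
        simp only [smul_eq_mul]
        linear_combination this
      have g00 := h.diffAt_coordMetric hu 0 0
      have g01 := h.diffAt_coordMetric hu 0 1
      have g11 := h.diffAt_coordMetric hu 1 1
      have b00 := h.diffAt_secondForm hu 0 0
      have b01 := h.diffAt_secondForm hu 0 1
      have b11 := h.diffAt_secondForm hu 1 1
      have e' := pd_congr e i
      rw [pd_add ((g11.fun_mul b00).fun_sub ((g01.fun_mul b01).fun_const_smul _)) (g00.fun_mul b11),
        pd_sub (g11.fun_mul b00) ((g01.fun_mul b01).fun_const_smul _), pd_const_smul _ (g01.fun_mul b01),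
        pd_const_smul _ ((g00.fun_mul g11).fun_sub (g01.fun_mul g01)), pd_sub (g00.fun_mul g11) (g01.fun_mul g01),
        pd_mul g11 b00, pd_mul g01 b01, pd_mul g00 b11, pd_mul g00 g11, pd_mul g01 g01] at e'
      simp only [smul_eq_mul] at e'
      linear_combination e') l
  have hs := h.secondForm_symm hu 1 0
  simp only [Fin.sum_univ_two] at key
  simp only [vecLaplacian, Fin.sum_univ_two, ip_neg_left, ip_add_left, ip_sub_left, ip_smul_left,
    h.ip_pd_n_pd_y hu, h00, h01, h10, h11]
  rw [pd_comm h.isOpen h.smooth_normal hu 1 0, h.christoffel_symm hu 0 1 0,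
    h.christoffel_symm hu 1 1 0]
  field_simp
  linear_combination -key

/-- The Laplacian of the unit normal of a surface of constant mean curvature. -/
lemma vecLaplacian_n {H D : ℝ}
    (hH : ∀ v ∈ U, ∑ i, ∑ j, (coordMetric y v)⁻¹ i j * secondForm y n i j v = H)
    (hD : secondForm y n 0 0 u * secondForm y n 1 1 u - secondForm y n 0 1 u ^ 2
      = D * (coordMetric y u).det) :
    vecLaplacian (coordMetric y) n u = (H ^ 2 - 2 * D) • n u + H • y u := by
  have hd := h.nondeg u hu
  obtain ⟨h00, h01, h10, h11⟩ := coordMetric_inv hd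
  have hs := h.secondForm_symm hu 1 0
  have htr := h.trace_mul_det hu (hH u hu)
  rw [← det_coordMetric] at htr
  rw [← sub_eq_zero]
  apply h.eq_zero hu
  -- This is the third fundamental form, by the Weingarten formula. Its trace is `tr S² = H² - 2D`,
  -- the coefficient of `n`; here `H` is the full trace, not its half.
  · have hnn (i j : Fin 2) : ip (pd i n u) (pd j n u)
        = ∑ k, (∑ l, (coordMetric y u)⁻¹ k l * secondForm y n i l u) * secondForm y n j k u := by
      have hj (k : Fin 2) : ip (pd k y u) (pd j n u) = -secondForm y n j k u := by
        rw [ip_comm, h.ip_pd_n_pd_y hu]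
      rw [h.pd_n hu i]
      simp only [ip_neg_left, Fin.sum_univ_two, ip_add_left, ip_smul_left, hj]
      ring
    simp only [vecLaplacian, Fin.sum_univ_two, ip_neg_left, ip_add_left, ip_sub_left,
      ip_smul_left, h.ip_pd_n_n hu, h.ip_pd_pd_n_n hu, hnn, h.ip_y_n hu, h.unit u hu]
    have e : H ^ 2 - 2 * D = ((coordMetric y u 1 1 * secondForm y n 0 0 u
        - 2 * coordMetric y u 0 1 * secondForm y n 0 1 u
        + coordMetric y u 0 0 * secondForm y n 1 1 u) ^ 2 - 2 * (secondForm y n 0 0 u *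
        secondForm y n 1 1 u - secondForm y n 0 1 u ^ 2) * (coordMetric y u).det)
        / (coordMetric y u).det ^ 2 := by
      rw [htr, hD]
      field_simp
    rw [e]
    simp only [h00, h01, h10, h11, hs]
    field_simp
    rw [det_coordMetric]
    ring
  · simp only [vecLaplacian, Fin.sum_univ_two, ip_neg_left, ip_add_left, ip_sub_left,
      ip_smul_left, h.ip_pd_n_y hu, h.ip_pd_pd_n_y hu, h.tangent u hu, h.mem u hu]
    have := hH u hu
    simp only [Fin.sum_univ_two] at this
    linear_combination -this
  · intro l
    simp only [ip_sub_left, ip_add_left, ip_smul_left, h.ip_vecLaplacian_n_pd hu hH,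
      h.normal u hu, h.ip_y_pd hu]
    ring

/-- Needed to differentiate the Gauss formula. By `christoffel_eq` the symbols are rational in
scalar products of derivatives of `y`, with denominator the nonzero determinant. -/
lemma diffAt_christoffel (k i j : Fin 2) :
    DifferentiableAt ℝ (christoffel (coordMetric y) k i j) u := by
  have h1 : ∀ l, DifferentiableAt ℝ (fun v => (coordMetric y v)⁻¹ k l) u := by
    intro l
    have hdet : DifferentiableAt ℝ (fun v => (coordMetric y v 0 0 * coordMetric y v 1 1
        - coordMetric y v 0 1 ^ 2)⁻¹) u := by
      refine DifferentiableAt.inv ?_ ?_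
      · exact ((h.diffAt_coordMetric hu 0 0).mul (h.diffAt_coordMetric hu 1 1)).sub
          ((h.diffAt_coordMetric hu 0 1).pow 2)
      · rw [← det_coordMetric]; exact h.nondeg u hu
    have hadj : DifferentiableAt ℝ (fun v => (coordMetric y v).adjugate k l) u := by
      simp only [Matrix.adjugate_fin_two]
      fin_cases k <;> fin_cases l
      · exact h.diffAt_coordMetric hu 1 1
      · exact (h.diffAt_coordMetric hu 0 1).neg
      · exact (h.diffAt_coordMetric hu 1 0).neg
      · exact h.diffAt_coordMetric hu 0 0
    simp only [Matrix.inv_def, Ring.inverse_eq_inv', Matrix.smul_apply, smul_eq_mul,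
      det_coordMetric]
    exact hdet.mul hadj
  have h2 : (christoffel (coordMetric y) k i j) =ᶠ[nhds u]
      fun v => ∑ l, (coordMetric y v)⁻¹ k l * ip (pd i (pd j y) v) (pd l y v) := by
    filter_upwards [h.eventually_mem hu] with v hv using h.christoffel_eq hv k i j
  refine DifferentiableAt.congr_of_eventuallyEq ?_ h2
  refine DifferentiableAt.fun_sum fun l _ => (h1 l).mul ?_
  exact differentiableAt_of_contDiffOn h.isOpen
    (contDiffOn_ip (contDiffOn_pd h.isOpen (contDiffOn_pd h.isOpen h.smooth j) i)
      (contDiffOn_pd h.isOpen h.smooth l)) hu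

/-- Third derivatives of the position vector, tested against a tangent vector. -/
lemma ip_pd_pd_pd_y (m i j r : Fin 2) :
    ip (pd m (pd i (pd j y)) u) (pd r y u)
      = ∑ k, (pd m (christoffel (coordMetric y) k i j) u
        + ∑ l, christoffel (coordMetric y) k m l u * christoffel (coordMetric y) l i j u)
          * coordMetric y u k r
        - secondForm y n i j u * secondForm y n m r u
        + coordMetric y u i j * coordMetric y u m r := by
  have h1 : pd i (pd j y) =ᶠ[nhds u] fun v => (christoffel (coordMetric y) 0 i j v • pd 0 y v
      + christoffel (coordMetric y) 1 i j v • pd 1 y v) + secondForm y n i j v • n v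
      + coordMetric y v i j • y v := by
    filter_upwards [h.eventually_mem hu] with v hv
    rw [h.pd_pd_y hv i j, Fin.sum_univ_two]
  have d0 := h.diffAt_christoffel hu 0 i j
  have d1 := h.diffAt_christoffel hu 1 i j
  have y0 := h.diffAt_pd_y hu 0
  have y1 := h.diffAt_pd_y hu 1
  have db := h.diffAt_secondForm hu i j
  have dg := h.diffAt_coordMetric hu i j
  have dn := h.diffAt_n hu
  have dy := h.diffAt_y hu
  rw [pd_congr h1, pd_add (((d0.fun_smul y0).fun_add (d1.fun_smul y1)).fun_add (db.fun_smul dn)) (dg.fun_smul dy),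
    pd_add ((d0.fun_smul y0).fun_add (d1.fun_smul y1)) (db.fun_smul dn), pd_add (d0.fun_smul y0) (d1.fun_smul y1),
    pd_smul d0 y0, pd_smul d1 y1, pd_smul db dn, pd_smul dg dy]
  simp only [ip_add_left, ip_smul_left, h.normal u hu, h.ip_y_pd hu, h.ip_pd_n_pd_y hu,
    ← coordMetric_apply, ← h.sum_christoffel_mul hu, Fin.sum_univ_two]
  ring

/-- The Gauss equation. -/
lemma coordGaussianCurvature_eq :
    coordGaussianCurvature (coordMetric y) u
      = (secondForm y n 0 0 u * secondForm y n 1 1 u - secondForm y n 0 1 u ^ 2)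
        / (coordMetric y u).det - 1 := by
  have hd := h.nondeg u hu
  -- The Gauss equation is the `∂₀y` component of the equality of the mixed derivatives of `∂₁y`.
  have h1 : pd 0 (pd 1 (pd 1 y)) u = pd 1 (pd 0 (pd 1 y)) u :=
    pd_comm h.isOpen (contDiffOn_pd h.isOpen h.smooth 1) hu 0 1
  have h2 := h.ip_pd_pd_pd_y hu 0 1 1 0
  rw [h1, h.ip_pd_pd_pd_y hu 1 0 1 0] at h2
  rw [coordGaussianCurvature]
  field_simp
  rw [det_coordMetric]
  simp only [Fin.sum_univ_two, coordCurvature] at h2 ⊢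
  rw [h.secondForm_symm hu 1 0, coordMetric_symm y u 1 0] at h2
  linear_combination -h2

end IsCoordSurface

/-! ### Linearity of the Laplacian in coordinates -/

lemma coordLaplacian_congr (g : Plane → Matrix (Fin 2) (Fin 2) ℝ) {f f' : Plane → ℝ} {u : Plane}
    (h : f =ᶠ[nhds u] f') : coordLaplacian g f u = coordLaplacian g f' u := by
  simp only [coordLaplacian, pd_congr h, pd_congr (pd_eventuallyEq h _)]

lemma coordLaplacian_clm (g : Plane → Matrix (Fin 2) (Fin 2) ℝ) {U : Set Plane} (hU : IsOpen U)
    {z : Plane → E42} (hz : ContDiffOn ℝ ∞ z U) {u : Plane} (hu : u ∈ U) (l : E42 →L[ℝ] ℝ) :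
    coordLaplacian g (fun v => l (z v)) u = l (vecLaplacian g z u) := by
  have h1 (i : Fin 2) : pd i (fun v => l (z v)) =ᶠ[nhds u] fun v => l (pd i z v) := by
    filter_upwards [hU.mem_nhds hu] with v hv
    exact pd_clm l (differentiableAt_of_contDiffOn hU hz hv) i
  have h2 (i j : Fin 2) : pd i (pd j fun v => l (z v)) u = l (pd i (pd j z) u) := by
    rw [pd_congr (h1 j),
      pd_clm l (differentiableAt_of_contDiffOn hU (contDiffOn_pd hU hz j) hu)]
  simp only [coordLaplacian, vecLaplacian, map_neg, map_sum, map_smul, map_sub, h2,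
    (h1 _).eq_of_nhds, smul_eq_mul]

lemma coordLaplacian_add (g : Plane → Matrix (Fin 2) (Fin 2) ℝ) {U : Set Plane} (hU : IsOpen U)
    {f f' : Plane → ℝ} (hf : ContDiffOn ℝ ∞ f U) (hf' : ContDiffOn ℝ ∞ f' U) {u : Plane}
    (hu : u ∈ U) :
    coordLaplacian g (fun v => f v + f' v) u = coordLaplacian g f u + coordLaplacian g f' u := by
  have h1 (i : Fin 2) : pd i (fun v => f v + f' v) =ᶠ[nhds u] fun v => pd i f v + pd i f' v := by
    filter_upwards [hU.mem_nhds hu] with v hv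
    exact pd_add (differentiableAt_of_contDiffOn hU hf hv)
      (differentiableAt_of_contDiffOn hU hf' hv) i
  have h2 (i j : Fin 2) : pd i (pd j fun v => f v + f' v) u
      = pd i (pd j f) u + pd i (pd j f') u := by
    rw [pd_congr (h1 j),
      pd_add (differentiableAt_of_contDiffOn hU (contDiffOn_pd hU hf j) hu)
        (differentiableAt_of_contDiffOn hU (contDiffOn_pd hU hf' j) hu)]
  simp only [coordLaplacian, h2, (h1 _).eq_of_nhds, Fin.sum_univ_two]
  ring

lemma coordLaplacian_const_mul (g : Plane → Matrix (Fin 2) (Fin 2) ℝ) {U : Set Plane}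
    (hU : IsOpen U) {f : Plane → ℝ} (hf : ContDiffOn ℝ ∞ f U) {u : Plane} (hu : u ∈ U) (c : ℝ) :
    coordLaplacian g (fun v => c * f v) u = c * coordLaplacian g f u := by
  have h1 (i : Fin 2) : pd i (fun v => c * f v) =ᶠ[nhds u] fun v => c • pd i f v := by
    filter_upwards [hU.mem_nhds hu] with v hv
    exact pd_const_smul c (differentiableAt_of_contDiffOn hU hf hv) i
  have h2 (i j : Fin 2) : pd i (pd j fun v => c * f v) u = c • pd i (pd j f) u := by
    rw [pd_congr (h1 j),
      pd_const_smul c (differentiableAt_of_contDiffOn hU (contDiffOn_pd hU hf j) hu)]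
  simp only [coordLaplacian, h2, (h1 _).eq_of_nhds, Fin.sum_univ_two, smul_eq_mul]
  ring

/-! ### Linear algebra of shape operators -/

section LinearAlgebra

variable {V : Type*} [AddCommGroup V] [Module ℝ V]

/-- Trace and determinant of an operator on a plane in terms of a basis. -/
lemma trace_det_of_basis (a : Module.Basis (Fin 2) ℝ V) (T : V →ₗ[ℝ] V) {m : Fin 2 → Fin 2 → ℝ}
    (h : ∀ i, T (a i) = ∑ k, m k i • a k) :
    LinearMap.trace ℝ V T = m 0 0 + m 1 1 ∧
      LinearMap.det T = m 0 0 * m 1 1 - m 0 1 * m 1 0 := by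
  have hm : LinearMap.toMatrix a a T = Matrix.of m := by
    ext k i
    rw [LinearMap.toMatrix_apply, h]
    fin_cases k <;> simp
  rw [LinearMap.trace_eq_matrix_trace ℝ a, ← LinearMap.det_toMatrix a, hm]
  exact ⟨by simp [Matrix.trace_fin_two], by simp [Matrix.det_fin_two]⟩

/-- Trace and determinant of an operator on a plane in terms of a symmetric bilinear form. -/
lemma trace_det_of_form (a : Module.Basis (Fin 2) ℝ V) (T : V →ₗ[ℝ] V) {X : V →ₗ[ℝ] E42} :
    LinearMap.trace ℝ V T * (ip (X (a 0)) (X (a 0)) * ip (X (a 1)) (X (a 1))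
        - ip (X (a 0)) (X (a 1)) ^ 2)
      = ip (X (a 1)) (X (a 1)) * ip (X (T (a 0))) (X (a 0))
        - ip (X (a 0)) (X (a 1)) * ip (X (T (a 0))) (X (a 1))
        - ip (X (a 0)) (X (a 1)) * ip (X (T (a 1))) (X (a 0))
        + ip (X (a 0)) (X (a 0)) * ip (X (T (a 1))) (X (a 1)) ∧
    LinearMap.det T * (ip (X (a 0)) (X (a 0)) * ip (X (a 1)) (X (a 1))
        - ip (X (a 0)) (X (a 1)) ^ 2)
      = ip (X (T (a 0))) (X (a 0)) * ip (X (T (a 1))) (X (a 1))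
        - ip (X (T (a 0))) (X (a 1)) * ip (X (T (a 1))) (X (a 0)) := by
  obtain ⟨m, h⟩ : ∃ m : Fin 2 → Fin 2 → ℝ, ∀ i, T (a i) = ∑ k, m k i • a k :=
    ⟨fun k i => a.repr (T (a i)) k, fun i => (a.sum_repr (T (a i))).symm⟩
  obtain ⟨h1, h2⟩ := trace_det_of_basis a T h
  rw [h1, h2, h 0, h 1]
  simp only [Fin.sum_univ_two, map_add, map_smul, ip_add_left, ip_smul_left,
    ip_comm (X (a 1)) (X (a 0))]
  constructor <;> ring

/-- An operator on a real plane that is not diagonalizable has nonpositive discriminant. -/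
lemma trace_sq_le_of_not_isDiagonalizable (a : Module.Basis (Fin 2) ℝ V) {T : V →ₗ[ℝ] V}
    (hT : ¬ IsDiagonalizable T) : LinearMap.trace ℝ V T ^ 2 ≤ 4 * LinearMap.det T := by
  by_contra! hlt
  apply hT
  have : Module.Finite ℝ V := Module.Finite.of_basis a
  obtain ⟨r, hr⟩ : ∃ r, r = Real.sqrt (LinearMap.trace ℝ V T ^ 2 - 4 * LinearMap.det T) := ⟨_, rfl⟩
  have hr0 : 0 < r := hr ▸ Real.sqrt_pos.2 (by linarith)
  have hr2 : r ^ 2 = LinearMap.trace ℝ V T ^ 2 - 4 * LinearMap.det T :=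
    hr ▸ Real.sq_sqrt (by linarith)
  obtain ⟨h1, h2⟩ := trace_det_of_basis a T (m := fun k i => a.repr (T (a i)) k)
    fun i => (a.sum_repr (T (a i))).symm
  -- Cayley–Hamilton in dimension two.
  have hCH (v : V) : T (T v) = LinearMap.trace ℝ V T • T v - LinearMap.det T • v := by
    have key (i) : T (T (a i)) = LinearMap.trace ℝ V T • T (a i) - LinearMap.det T • a i := by
      have e0 : T (a 0) = a.repr (T (a 0)) 0 • a 0 + a.repr (T (a 0)) 1 • a 1 := by
        rw [← Fin.sum_univ_two (f := fun k => a.repr (T (a 0)) k • a k), a.sum_repr]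
      have e1 : T (a 1) = a.repr (T (a 1)) 0 • a 0 + a.repr (T (a 1)) 1 • a 1 := by
        rw [← Fin.sum_univ_two (f := fun k => a.repr (T (a 1)) k • a k), a.sum_repr]
      rw [h1, h2]
      generalize a.repr (T (a 0)) 0 = m00 at *
      generalize a.repr (T (a 0)) 1 = m10 at *
      generalize a.repr (T (a 1)) 0 = m01 at *
      generalize a.repr (T (a 1)) 1 = m11 at *
      fin_cases i
      · simp only [Fin.zero_eta, e0, map_add, map_smul, e1]
        module
      · simp only [Fin.mk_one, e1, map_add, map_smul, e0]
        module
    have : T ∘ₗ T = LinearMap.trace ℝ V T • T - LinearMap.det T • LinearMap.id :=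
      a.ext fun i => by simpa using key i
    exact congrArg (fun f : V →ₗ[ℝ] V => f v) this
  rw [IsDiagonalizable, eq_top_iff]
  intro v _
  set t := LinearMap.trace ℝ V T
  set d := LinearMap.det T
  -- With the distinct eigenvalues `(t ± r) / 2`, the vector `T v - ((t - r) / 2) v` is an
  -- eigenvector or zero for `(t + r) / 2`, and conversely; their difference is `r v`.
  have hv : v = r⁻¹ • (T v - ((t - r) / 2) • v) + (-r⁻¹) • (T v - ((t + r) / 2) • v) := by
    have : v = (r⁻¹ * r) • v := by rw [inv_mul_cancel₀ hr0.ne', one_smul]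
    nth_rewrite 1 [this]
    module
  rw [hv]
  refine Submodule.add_mem _ (Submodule.smul_mem _ _ ?_) (Submodule.smul_mem _ _ ?_)
  · refine Submodule.mem_iSup_of_mem ((t + r) / 2) (Module.End.mem_eigenspace_iff.2 ?_)
    have hd : d = (t ^ 2 - r ^ 2) / 4 := by linarith
    rw [map_sub, map_smul, hCH, hd]
    module
  · refine Submodule.mem_iSup_of_mem ((t - r) / 2) (Module.End.mem_eigenspace_iff.2 ?_)
    have hd : d = (t ^ 2 - r ^ 2) / 4 := by linarith
    rw [map_sub, map_smul, hCH, hd]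
    module

end LinearAlgebra

/-! ### Coordinate vectors of a chart -/

section Charts

variable {M : Type*} [TopologicalSpace M] [ChartedSpace Plane M] [IsManifold (𝓡 2) ∞ M]

lemma contDiffOn_comp_chart_symm {F : Type*} [NormedAddCommGroup F] [NormedSpace ℝ F] {f : M → F}
    (hf : ContMDiff (𝓡 2) 𝓘(ℝ, F) ∞ f) (p : M) :
    ContDiffOn ℝ ∞ (f ∘ (chartAt Plane p).symm) (chartAt Plane p).target :=
  (hf.comp_contMDiffOn (contMDiffOn_chart_symm (I := 𝓡 2))).contDiffOn

/-- The differential of the inverse of the preferred chart at `p`. -/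
def chartEquiv (p : M) {u : Plane} (hu : u ∈ (chartAt Plane p).target) :
    Plane ≃ₗ[ℝ] TangentSpace (𝓡 2) ((chartAt Plane p).symm u) :=
  LinearEquiv.ofBijective
    (mfderiv (𝓡 2) (𝓡 2) (chartAt Plane p).symm u : Plane →L[ℝ] _).toLinearMap
    ((mdifferentiable_chart p).symm.mfderiv_bijective hu)

/-- The coordinate basis of the tangent plane. -/
def chartBasis (p : M) {u : Plane} (hu : u ∈ (chartAt Plane p).target) :
    Module.Basis (Fin 2) ℝ (TangentSpace (𝓡 2) ((chartAt Plane p).symm u)) :=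
  (EuclideanSpace.basisFun (Fin 2) ℝ).toBasis.map (chartEquiv p hu)

lemma chartBasis_apply (p : M) {u : Plane} (hu : u ∈ (chartAt Plane p).target) (i : Fin 2) :
    chartBasis p hu i
      = mfderiv (𝓡 2) (𝓡 2) (chartAt Plane p).symm u (EuclideanSpace.single i (1 : ℝ)) := by
  have h : (EuclideanSpace.basisFun (Fin 2) ℝ).toBasis i = EuclideanSpace.single i (1 : ℝ) := by
    simp
  rw [← h]
  exact Module.Basis.map_apply _ _ i

lemma pd_comp_chart_symm {F : Type*} [NormedAddCommGroup F] [NormedSpace ℝ F] {f : M → F}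
    (hf : ContMDiff (𝓡 2) 𝓘(ℝ, F) ∞ f) (p : M) {u : Plane} (hu : u ∈ (chartAt Plane p).target)
    (i : Fin 2) :
    pd i (f ∘ (chartAt Plane p).symm) u
      = mfderiv (𝓡 2) 𝓘(ℝ, F) f ((chartAt Plane p).symm u) (chartBasis p hu i) := by
  have h1 : MDifferentiableAt (𝓡 2) 𝓘(ℝ, F) f ((chartAt Plane p).symm u) :=
    hf.mdifferentiableAt (by simp)
  have h2 : MDifferentiableAt (𝓡 2) (𝓡 2) (chartAt Plane p).symm u :=
    (mdifferentiable_chart p).symm.mdifferentiableAt hu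
  rw [pd, ← mfderiv_eq_fderiv, mfderiv_comp u h1 h2, chartBasis_apply]
  rfl

end Charts

/-! ### Transfer of the local formulas to the immersed surface -/

section Surfaces

variable {M : Type*} [TopologicalSpace M] [ChartedSpace Plane M]

/-- The differential as a linear map. -/
def diffL (x : M → E42) (p : M) : TangentSpace (𝓡 2) p →ₗ[ℝ] E42 :=
  (mfderiv (𝓡 2) 𝓘(ℝ, E42) x p).toLinearMap

lemma diffL_apply (x : M → E42) (p : M) (v : TangentSpace (𝓡 2) p) :
    diffL x p v = diff x p v := rfl

variable [IsManifold (𝓡 2) ∞ M] {x N : M → E42}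
  {S : ∀ p : M, TangentSpace (𝓡 2) p →ₗ[ℝ] TangentSpace (𝓡 2) p}

lemma pd_comp_chart_symm_eq_diffL {f : M → E42} (hf : ContMDiff (𝓡 2) 𝓘(ℝ, E42) ∞ f) (p : M)
    {u : Plane} (hu : u ∈ (chartAt Plane p).target) (i : Fin 2) :
    pd i (f ∘ (chartAt Plane p).symm) u
      = diffL f ((chartAt Plane p).symm u) (chartBasis p hu i) :=
  pd_comp_chart_symm hf p hu i

/-- A change of basis multiplies the Gram determinant by a square, and an orthonormal frame of index
one has Gram determinant `-1`. -/
lemma det_coordMetric_neg (hx : IsLorentzianSurface x) (p : M) {u : Plane}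
    (hu : u ∈ (chartAt Plane p).target) :
    (coordMetric (x ∘ (chartAt Plane p).symm) u).det < 0 := by
  obtain ⟨e₁, e₂, h1, h2, h3⟩ := hx.lorentzian ((chartAt Plane p).symm u)
  have hexp (v) : diff x ((chartAt Plane p).symm u) v
      = (chartBasis p hu).repr v 0 • pd 0 (x ∘ (chartAt Plane p).symm) u
        + (chartBasis p hu).repr v 1 • pd 1 (x ∘ (chartAt Plane p).symm) u := by
    rw [pd_comp_chart_symm_eq_diffL hx.smooth p hu, pd_comp_chart_symm_eq_diffL hx.smooth p hu,
      ← (diffL x _).map_smul, ← (diffL x _).map_smul, ← (diffL x _).map_add, ← diffL_apply]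
    congr 1
    rw [← Fin.sum_univ_two (f := fun k => (chartBasis p hu).repr v k • chartBasis p hu k),
      Module.Basis.sum_repr]
  simp only [inducedMetric, hexp] at h1 h2 h3
  rw [det_coordMetric]
  simp only [coordMetric_apply]
  generalize (chartBasis p hu).repr e₁ 0 = a at *
  generalize (chartBasis p hu).repr e₁ 1 = b at *
  generalize (chartBasis p hu).repr e₂ 0 = c at *
  generalize (chartBasis p hu).repr e₂ 1 = d at *
  generalize pd 0 (x ∘ (chartAt Plane p).symm) u = v at *
  generalize pd 1 (x ∘ (chartAt Plane p).symm) u = w at *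
  simp only [ip_add_left, ip_add_right, ip_smul_left, ip_smul_right, ip_comm w v] at h1 h2 h3
  have key : (a * d - b * c) ^ 2 * (ip v v * ip w w - ip v w ^ 2) = -1 := by
    have : (-1 : ℝ) * 1 - 0 * 0 = -1 := by norm_num
    rw [← this]
    nth_rewrite 1 [← h1]
    nth_rewrite 1 [← h2]
    nth_rewrite 1 [← h3]
    nth_rewrite 1 [← h3]
    ring
  by_contra! hle
  nlinarith [mul_nonneg (sq_nonneg (a * d - b * c)) hle]

lemma isCoordSurface (hx : IsLorentzianSurface x) (hN : IsUnitNormal x N) (p : M) :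
    IsCoordSurface (chartAt Plane p).target (x ∘ (chartAt Plane p).symm)
      (N ∘ (chartAt Plane p).symm) where
  isOpen := (chartAt Plane p).open_target
  smooth := contDiffOn_comp_chart_symm hx.smooth p
  smooth_normal := contDiffOn_comp_chart_symm hN.smooth p
  mem _ _ := hx.mem _
  unit _ _ := hN.unit _
  tangent _ _ := hN.tangent _
  normal u hu i := by
    rw [pd_comp_chart_symm_eq_diffL hx.smooth p hu]
    exact hN.normal _ _
  nondeg u hu := (det_coordMetric_neg hx p hu).ne

lemma secondForm_eq (hx : IsLorentzianSurface x) (hN : IsUnitNormal x N)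
    (hS : IsShapeOperator x N S) (p : M) {u : Plane} (hu : u ∈ (chartAt Plane p).target)
    (i j : Fin 2) :
    secondForm (x ∘ (chartAt Plane p).symm) (N ∘ (chartAt Plane p).symm) i j u
      = ip (diffL x _ (S _ (chartBasis p hu i))) (diffL x _ (chartBasis p hu j)) := by
  have h := (isCoordSurface hx hN p).ip_pd_n_pd_y hu i j
  have h2 : diffL x _ (S _ (chartBasis p hu i)) = -diffL N _ (chartBasis p hu i) := hS _ _
  rw [pd_comp_chart_symm_eq_diffL hx.smooth p hu, pd_comp_chart_symm_eq_diffL hN.smooth p hu] at h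
  rw [h2, ip_neg_left, h, neg_neg]

/-- Identifies the trace `H` of the coordinate formulas: it is twice the mean curvature, which
accounts for the factors in the global Laplacians. -/
lemma sum_inv_mul_secondForm (hx : IsLorentzianSurface x) (hN : IsUnitNormal x N)
    (hS : IsShapeOperator x N S) (p : M) {u : Plane} (hu : u ∈ (chartAt Plane p).target) :
    ∑ i, ∑ j, (coordMetric (x ∘ (chartAt Plane p).symm) u)⁻¹ i j
        * secondForm (x ∘ (chartAt Plane p).symm) (N ∘ (chartAt Plane p).symm) i j u
      = 2 * meanCurvature S ((chartAt Plane p).symm u) := by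
  have hd := (det_coordMetric_neg hx p hu).ne
  obtain ⟨h00, h01, h10, h11⟩ := IsCoordSurface.coordMetric_inv hd
  have ht := (trace_det_of_form (chartBasis p hu) (S _) (X := diffL x _)).1
  simp only [← secondForm_eq hx hN hS] at ht
  simp only [← pd_comp_chart_symm_eq_diffL hx.smooth,
    ← coordMetric_apply, ← det_coordMetric] at ht
  simp only [Fin.sum_univ_two, h00, h01, h10, h11, meanCurvature]
  field_simp
  linear_combination -ht

lemma det_secondForm (hx : IsLorentzianSurface x) (hN : IsUnitNormal x N)
    (hS : IsShapeOperator x N S) (p : M) {u : Plane} (hu : u ∈ (chartAt Plane p).target) :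
    secondForm (x ∘ (chartAt Plane p).symm) (N ∘ (chartAt Plane p).symm) 0 0 u
        * secondForm (x ∘ (chartAt Plane p).symm) (N ∘ (chartAt Plane p).symm) 1 1 u
        - secondForm (x ∘ (chartAt Plane p).symm) (N ∘ (chartAt Plane p).symm) 0 1 u ^ 2
      = LinearMap.det (S ((chartAt Plane p).symm u))
        * (coordMetric (x ∘ (chartAt Plane p).symm) u).det := by
  have ht := (trace_det_of_form (chartBasis p hu) (S _) (X := diffL x _)).2
  simp only [← secondForm_eq hx hN hS] at ht
  simp only [← pd_comp_chart_symm_eq_diffL hx.smooth,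
    ← coordMetric_apply, ← det_coordMetric] at ht
  rw [ht, (isCoordSurface hx hN p).secondForm_symm hu 1 0]
  ring

/-- The Gauss equation. -/
lemma gaussianCurvature_eq (hx : IsLorentzianSurface x) (hN : IsUnitNormal x N)
    (hS : IsShapeOperator x N S) (p : M) :
    gaussianCurvature x p = LinearMap.det (S p) - 1 := by
  have hu := mem_chart_target Plane p
  have hd := (det_coordMetric_neg hx p hu).ne
  have h1 := (isCoordSurface hx hN p).coordGaussianCurvature_eq hu
  rw [det_secondForm hx hN hS p hu] at h1
  rw [(chartAt Plane p).left_inv (mem_chart_source Plane p)] at h1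
  change coordGaussianCurvature (coordMetric (x ∘ (chartAt Plane p).symm)) _ = _
  rw [h1]
  field_simp

lemma laplacian_position (hx : IsLorentzianSurface x) (hN : IsUnitNormal x N)
    (hS : IsShapeOperator x N S) (l : E42 →L[ℝ] ℝ) (p : M) :
    laplacian x (fun q => l (x q)) p
      = -2 * meanCurvature S p * l (N p) - 2 * l (x p) := by
  have hu := mem_chart_target Plane p
  have h1 := (isCoordSurface hx hN p).vecLaplacian_y hu (sum_inv_mul_secondForm hx hN hS p hu)
  change coordLaplacian (coordMetric (x ∘ (chartAt Plane p).symm))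
    (fun v => l ((x ∘ (chartAt Plane p).symm) v)) _ = _
  rw [coordLaplacian_clm _ (chartAt Plane p).open_target (contDiffOn_comp_chart_symm hx.smooth p)
    hu, h1]
  simp only [Function.comp_apply, (chartAt Plane p).left_inv (mem_chart_source Plane p)]
  simp

/-- Together with `laplacian_position`, this gives the matrix of the Laplacian on the span of `N`
and `x`, on which every spectral statement rests. -/
lemma laplacian_normal (hx : IsLorentzianSurface x) (hN : IsUnitNormal x N)
    (hS : IsShapeOperator x N S) {h : ℝ} (hh : ∀ p, meanCurvature S p = h)
    (l : E42 →L[ℝ] ℝ) (p : M) :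
    laplacian x (fun q => l (N q)) p
      = (4 * h ^ 2 - 2 * LinearMap.det (S p)) * l (N p) + 2 * h * l (x p) := by
  have hu := mem_chart_target Plane p
  have h1 := (isCoordSurface hx hN p).vecLaplacian_n hu (H := 2 * h)
    (fun v hv => by rw [sum_inv_mul_secondForm hx hN hS p hv, hh])
    (det_secondForm hx hN hS p hu)
  rw [(chartAt Plane p).left_inv (mem_chart_source Plane p)] at h1
  change coordLaplacian (coordMetric (x ∘ (chartAt Plane p).symm))
    (fun v => l ((N ∘ (chartAt Plane p).symm) v)) _ = _
  rw [coordLaplacian_clm _ (chartAt Plane p).open_target (contDiffOn_comp_chart_symm hN.smooth p)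
    hu, h1]
  simp only [Function.comp_apply, (chartAt Plane p).left_inv (mem_chart_source Plane p)]
  simp only [map_add, map_smul, smul_eq_mul]
  ring

/-! ### Linearity of the Laplacian -/

omit [IsManifold (𝓡 2) ∞ M] in
lemma laplacian_congr {f f' : M → ℝ} {p : M} (h : f =ᶠ[nhds p] f') :
    laplacian x f p = laplacian x f' p := by
  refine coordLaplacian_congr _ ?_
  have hc : Filter.Tendsto (chartAt Plane p).symm (nhds (chartAt Plane p p)) (nhds p) := by
    have := (chartAt Plane p).continuousAt_symm (mem_chart_target Plane p)
    rwa [ContinuousAt, (chartAt Plane p).left_inv (mem_chart_source Plane p)] at this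
  exact hc.eventually h

lemma laplacian_add {f f' : M → ℝ} (hf : ContMDiff (𝓡 2) 𝓘(ℝ, ℝ) ∞ f)
    (hf' : ContMDiff (𝓡 2) 𝓘(ℝ, ℝ) ∞ f') (p : M) :
    laplacian x (fun q => f q + f' q) p = laplacian x f p + laplacian x f' p :=
  coordLaplacian_add _ (chartAt Plane p).open_target (contDiffOn_comp_chart_symm hf p)
    (contDiffOn_comp_chart_symm hf' p) (mem_chart_target Plane p)

lemma laplacian_const_mul {f : M → ℝ} (hf : ContMDiff (𝓡 2) 𝓘(ℝ, ℝ) ∞ f) (c : ℝ) (p : M) :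
    laplacian x (fun q => c * f q) p = c * laplacian x f p :=
  coordLaplacian_const_mul _ (chartAt Plane p).open_target (contDiffOn_comp_chart_symm hf p)
    (mem_chart_target Plane p) c

lemma laplacian_zero (p : M) : laplacian x (fun _ => 0) p = 0 := by
  have := laplacian_const_mul (x := x) (f := fun _ => (0 : ℝ)) contMDiff_const 0 p
  simpa using this

lemma laplacian_sum {ι : Type*} (s : Finset ι) {f : ι → M → ℝ}
    (hf : ∀ i, ContMDiff (𝓡 2) 𝓘(ℝ, ℝ) ∞ (f i)) (p : M) :
    laplacian x (fun q => ∑ i ∈ s, f i q) p = ∑ i ∈ s, laplacian x (f i) p := by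
  classical
  induction s using Finset.induction_on with
  | empty => simpa using laplacian_zero p
  | insert a s ha ih =>
    simp only [Finset.sum_insert ha]
    rw [laplacian_add (hf a) (contMDiff_finsetSum fun i _ => hf i), ih]

end Surfaces

/-! ### Orientation and the Gauss map -/

lemma det_map_plane (n y : E42) (X : Plane →ₗ[ℝ] E42) (v w : Plane) :
    (Matrix.of ![n, y, X v, X w]).det = (v 0 * w 1 - v 1 * w 0)
      * (Matrix.of ![n, y, X (EuclideanSpace.single 0 1), X (EuclideanSpace.single 1 1)]).det := by
  have hexp (v : Plane) : X v
      = v 0 • X (EuclideanSpace.single 0 1) + v 1 • X (EuclideanSpace.single 1 1) := by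
    rw [← map_smul, ← map_smul, ← map_add]
    congr 1
    ext i
    fin_cases i <;> simp
  rw [hexp v, hexp w]
  generalize X (EuclideanSpace.single 0 1) = a
  generalize X (EuclideanSpace.single 1 1) = b
  simp [Matrix.det_succ_row_zero, Fin.sum_univ_succ, Fin.succAbove]
  ring

lemma det_fin_two_plane (v w : Plane) :
    (EuclideanSpace.basisFun (Fin 2) ℝ).toBasis.det ![v, w] = v 0 * w 1 - v 1 * w 0 := by
  rw [Module.Basis.det_apply, Matrix.det_fin_two]
  simp [Module.Basis.toMatrix_apply]
  ring

lemma sign_mul_of_pos {c : ℝ} (hc : 0 < c) (a : ℝ) : Real.sign (c * a) = Real.sign a := by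
  rcases lt_trichotomy a 0 with h | h | h
  · rw [Real.sign_of_neg h, Real.sign_of_neg (mul_neg_of_pos_of_neg hc h)]
  · simp [h]
  · rw [Real.sign_of_pos h, Real.sign_of_pos (mul_pos hc h)]

section Orientation

variable {M : Type*} [TopologicalSpace M] [ChartedSpace Plane M]

/-- The volume form of `𝔼⁴₂` on `(N, x, x_* ∂₀, x_* ∂₁)`, for the coordinate vectors `∂ᵢ` at `q` of
the preferred chart at `q`. -/
def frameDet (x N : M → E42) (q : M) : ℝ :=
  (Matrix.of ![N q, x q, diff x q (EuclideanSpace.single 0 1 : Plane),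
    diff x q (EuclideanSpace.single 1 1 : Plane)]).det

/-- The sign by which `N` differs from the oriented unit normal. -/
def orientSign (x N : M → E42) (q : M) : ℝ := Real.sign (frameDet x N q)

lemma det_frame (x N : M → E42) (q : M) (v w : TangentSpace (𝓡 2) q) :
    (Matrix.of ![N q, x q, diff x q v, diff x q w]).det
      = (EuclideanSpace.basisFun (Fin 2) ℝ).toBasis.det ![(v : Plane), (w : Plane)]
        * frameDet x N q := by
  exact (det_map_plane (N q) (x q) (diffL x q) v w).trans
    (congrArg (· * frameDet x N q) (det_fin_two_plane v w).symm)

variable [IsManifold (𝓡 2) ∞ M] {x N : M → E42}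

/-- Tangent vectors at a point are written in the preferred chart at that point, so coordinate
vectors of another chart appear as columns of the Jacobian of the coordinate change. -/
lemma chartBasis_eq_fderiv (p : M) {u : Plane} (hu : u ∈ (chartAt Plane p).target) (i : Fin 2) :
    chartBasis p hu i = (fderiv ℝ ((chartAt Plane p).symm.trans
      (chartAt Plane ((chartAt Plane p).symm u))) u (EuclideanSpace.single i 1) : Plane) := by
  rw [chartBasis_apply, MDifferentiableAt.mfderiv
    ((mdifferentiable_chart p).symm.mdifferentiableAt hu)]
  simp [writtenInExtChartAt, extChartAt]
  rfl

lemma det_chartBasis_pos (hM : IsOrientedAtlas M) (p : M) {u : Plane}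
    (hu : u ∈ (chartAt Plane p).target) :
    0 < (EuclideanSpace.basisFun (Fin 2) ℝ).toBasis.det
      ![(chartBasis p hu 0 : Plane), (chartBasis p hu 1 : Plane)] := by
  have h := hM _ (chart_mem_atlas Plane p) _
    (chart_mem_atlas Plane ((chartAt Plane p).symm u)) u
    (by simp [hu])
  rw [chartBasis_eq_fderiv, chartBasis_eq_fderiv, det_fin_two_plane]
  generalize fderiv ℝ ((chartAt Plane p).symm.trans
      (chartAt Plane ((chartAt Plane p).symm u))) u = A at h ⊢
  have hA := (trace_det_of_basis (EuclideanSpace.basisFun (Fin 2) ℝ).toBasis (A : Plane →ₗ[ℝ] Plane)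
    (m := fun k i => A (EuclideanSpace.single i 1) k) (fun i => by
      ext k
      fin_cases k <;> simp)).2
  have h' : 0 < LinearMap.det (A : Plane →ₗ[ℝ] Plane) := h
  rw [hA] at h'
  linarith

/-- `frameDet` may jump, because the preferred chart varies with the point. In a fixed chart the
determinant is continuous, and it differs from `frameDet` only by a positive Jacobian. -/
lemma det_chart_frame (hM : IsOrientedAtlas M) (hx : IsLorentzianSurface x) (N : M → E42) (p : M)
    {u : Plane} (hu : u ∈ (chartAt Plane p).target) :
    ∃ c : ℝ, 0 < c ∧ (Matrix.of ![(N ∘ (chartAt Plane p).symm) u, (x ∘ (chartAt Plane p).symm) u,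
      pd 0 (x ∘ (chartAt Plane p).symm) u, pd 1 (x ∘ (chartAt Plane p).symm) u]).det
        = c * frameDet x N ((chartAt Plane p).symm u) := by
  refine ⟨_, det_chartBasis_pos hM p hu, ?_⟩
  rw [← det_frame, pd_comp_chart_symm_eq_diffL hx.smooth p hu,
    pd_comp_chart_symm_eq_diffL hx.smooth p hu]
  rfl

lemma det_chart_frame_ne_zero (hx : IsLorentzianSurface x) (hN : IsUnitNormal x N)
    (p : M) {u : Plane} (hu : u ∈ (chartAt Plane p).target) :
    (Matrix.of ![(N ∘ (chartAt Plane p).symm) u, (x ∘ (chartAt Plane p).symm) u,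
      pd 0 (x ∘ (chartAt Plane p).symm) u, pd 1 (x ∘ (chartAt Plane p).symm) u]).det ≠ 0 := by
  have h := isCoordSurface hx hN p
  have h1 := det_sq_of_adapted (h.mem u hu) (h.unit u hu) (h.tangent u hu) (h.normal u hu 0)
    (h.normal u hu 1) (h.ip_y_pd hu 0) (h.ip_y_pd hu 1)
  have h2 := det_coordMetric_neg hx p hu
  rw [det_coordMetric] at h2
  simp only [coordMetric_apply] at h2
  intro h0
  rw [h0] at h1
  linarith

lemma frameDet_ne_zero (hM : IsOrientedAtlas M) (hx : IsLorentzianSurface x)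
    (hN : IsUnitNormal x N) (p : M) : frameDet x N p ≠ 0 := by
  obtain ⟨c, -, hc⟩ := det_chart_frame hM hx N p (mem_chart_target Plane p)
  have h := det_chart_frame_ne_zero hx hN p (mem_chart_target Plane p)
  rw [hc, (chartAt Plane p).left_inv (mem_chart_source Plane p)] at h
  exact right_ne_zero_of_mul h

/-- The determinant in a fixed chart is continuous and never zero. Only local constancy is obtained,
since `M` need not be connected. -/
lemma orientSign_eventuallyEq (hM : IsOrientedAtlas M) (hx : IsLorentzianSurface x)
    (hN : IsUnitNormal x N) (p : M) : ∀ᶠ q in nhds p, orientSign x N q = orientSign x N p := by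
  have hS := isCoordSurface hx hN p
  have hu := mem_chart_target Plane p
  set F : Plane → ℝ := fun u => (Matrix.of ![(N ∘ (chartAt Plane p).symm) u,
    (x ∘ (chartAt Plane p).symm) u, pd 0 (x ∘ (chartAt Plane p).symm) u,
    pd 1 (x ∘ (chartAt Plane p).symm) u]).det with hF
  have hsign : ∀ u ∈ (chartAt Plane p).target,
      Real.sign (F u) = orientSign x N ((chartAt Plane p).symm u) := by
    intro u hu
    obtain ⟨c, hc, hc'⟩ := det_chart_frame hM hx N p hu
    rw [hF, orientSign]
    simp only [hc', sign_mul_of_pos hc]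
  have hcont : ContinuousAt F (chartAt Plane p p) := by
    have hm : ContinuousAt (fun u => Matrix.of ![(N ∘ (chartAt Plane p).symm) u,
        (x ∘ (chartAt Plane p).symm) u, pd 0 (x ∘ (chartAt Plane p).symm) u,
        pd 1 (x ∘ (chartAt Plane p).symm) u]) (chartAt Plane p p) := by
      refine continuousAt_pi.2 fun i => ?_
      fin_cases i
      · exact (hS.diffAt_n hu).continuousAt
      · exact (hS.diffAt_y hu).continuousAt
      · exact (hS.diffAt_pd_y hu 0).continuousAt
      · exact (hS.diffAt_pd_y hu 1).continuousAt
    exact (continuous_id.matrix_det.continuousAt).comp hm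
  have hne : F (chartAt Plane p p) ≠ 0 := det_chart_frame_ne_zero hx hN p hu
  have hev : ∀ᶠ u in nhds (chartAt Plane p p), Real.sign (F u) = Real.sign (F (chartAt Plane p p)) := by
    rcases hne.lt_or_gt with h | h
    · filter_upwards [hcont.eventually (gt_mem_nhds h)] with u hu
      rw [Real.sign_of_neg hu, Real.sign_of_neg h]
    · filter_upwards [hcont.eventually (lt_mem_nhds h)] with u hu
      rw [Real.sign_of_pos hu, Real.sign_of_pos h]
  have hc : ContinuousAt (chartAt Plane p) p :=
    (chartAt Plane p).continuousAt (mem_chart_source Plane p)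
  filter_upwards [hc.eventually hev,
    (chartAt Plane p).open_source.mem_nhds (mem_chart_source Plane p)] with q hq hq'
  rw [hsign _ ((chartAt Plane p).map_source hq'), hsign _ hu, (chartAt Plane p).left_inv hq',
    (chartAt Plane p).left_inv (mem_chart_source Plane p)] at hq
  exact hq

omit [IsManifold (𝓡 2) ∞ M] in
lemma apply_diff_of_comp_const {G : Type*} [NormedAddCommGroup G] [NormedSpace ℝ G] {f : M → E42}
    {p : M} (hf : MDifferentiableAt (𝓡 2) 𝓘(ℝ, E42) f p) {g : E42 → G} {g' : E42 →L[ℝ] G}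
    (hg : HasFDerivAt g g' (f p)) {c : G} (hc : ∀ q, g (f q) = c) (v : TangentSpace (𝓡 2) p) :
    g' (diff f p v) = 0 := by
  have h1 : g ∘ f = fun _ => c := funext hc
  have h2 := mfderiv_comp p hg.hasMFDerivAt.mdifferentiableAt hf
  rw [h1, mfderiv_const, hg.hasMFDerivAt.mfderiv] at h2
  exact (congrArg (fun A : TangentSpace (𝓡 2) p →L[ℝ] G => A v) h2).symm

omit [IsManifold (𝓡 2) ∞ M] in
lemma ip_position_diff (hx : IsLorentzianSurface x) (p : M) (v : TangentSpace (𝓡 2) p) :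
    ip (x p) (diff x p v) = 0 := by
  have h := apply_diff_of_comp_const (hx.smooth.mdifferentiableAt (by simp))
    (ipL.hasFDerivAt_of_bilinear (hasFDerivAt_id (x p)) (hasFDerivAt_id (x p)))
    (c := (-1 : ℝ)) (fun q => hx.mem q) v
  simp [ip_comm _ (x p)] at h
  linarith

omit [IsManifold (𝓡 2) ∞ M] in
-- Exchanging the two vectors reverses the orientation, and unit length is only required up to sign.
lemma exists_isPositiveOrthonormalFrame (hx : IsLorentzianSurface x)
    (hN : IsUnitNormal x N) (p : M) :
    ∃ e₁ e₂ : TangentSpace (𝓡 2) p, IsPositiveOrthonormalFrame x p e₁ e₂ := by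
  obtain ⟨e₁, e₂, h1, h2, h3⟩ := hx.lorentzian p
  have hd := det_sq_of_adapted (hx.mem p) (hN.unit p) (hN.tangent p) (hN.normal p e₁)
    (hN.normal p e₂) (ip_position_diff hx p e₁) (ip_position_diff hx p e₂)
  simp only [inducedMetric] at h1 h2 h3
  rw [h1, h2, h3, det_frame] at hd
  have hswap : (EuclideanSpace.basisFun (Fin 2) ℝ).toBasis.det ![(e₂ : Plane), (e₁ : Plane)]
      = -(EuclideanSpace.basisFun (Fin 2) ℝ).toBasis.det ![(e₁ : Plane), (e₂ : Plane)] :=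
    (det_fin_two_plane e₂ e₁).trans (Eq.trans (by ring) (congrArg Neg.neg
      (det_fin_two_plane e₁ e₂).symm))
  rcases lt_trichotomy ((EuclideanSpace.basisFun (Fin 2) ℝ).toBasis.det
    ![(e₁ : Plane), (e₂ : Plane)]) 0 with h | h | h
  · exact ⟨e₂, e₁, by simp [inducedMetric, h2], by simp [inducedMetric, h1],
      by rw [inducedMetric, ip_comm, h3], hswap ▸ neg_pos.2 h⟩
  · rw [h] at hd
    norm_num at hd
  · exact ⟨e₁, e₂, by simp [inducedMetric, h1], by simp [inducedMetric, h2],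
      by rw [inducedMetric, h3], h⟩

omit [IsManifold (𝓡 2) ∞ M] in
/-- The Gauss map is the Hodge dual of the oriented unit normal. -/
lemma gaussMap_eq (hx : IsLorentzianSurface x) (hN : IsUnitNormal x N)
    {ν : M → ⋀[ℝ]^3 E42} (hν : IsGaussMap x ν) (p : M) :
    ν p = orientSign x N p • hodgeStar (N p) := by
  obtain ⟨e₁, e₂, he⟩ := exists_isPositiveOrthonormalFrame hx hN p
  rw [hν p e₁ e₂ he, ιMulti_eq_hodgeStar, ← map_smul]
  congr 1
  have h1 := he.unit₁
  have h2 := he.unit₂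
  have h3 := he.orthogonal
  simp only [inducedMetric] at h1 h2 h3
  have hd := det_sq_of_adapted (hx.mem p) (hN.unit p) (hN.tangent p) (hN.normal p e₁)
    (hN.normal p e₂) (ip_position_diff hx p e₁) (ip_position_diff hx p e₂)
  have hne : ip (diff x p e₁) (diff x p e₁) * ip (diff x p e₂) (diff x p e₂)
      - ip (diff x p e₁) (diff x p e₂) ^ 2 ≠ 0 := by
    rw [h3]
    have : |ip (diff x p e₁) (diff x p e₁) * ip (diff x p e₂) (diff x p e₂)| = 1 := by
      rw [abs_mul, h1, h2, one_mul]
    intro h0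
    rw [← sub_zero (_ * _), ← zero_pow two_ne_zero, h0] at this
    simp at this
  -- The Gram determinant shows that this determinant is `±1`; positivity of the frame decides the
  -- sign.
  have hdet : (Matrix.of ![N p, x p, diff x p e₁, diff x p e₂]).det = orientSign x N p := by
    have hpos := he.positive
    have hs : (Matrix.of ![N p, x p, diff x p e₁, diff x p e₂]).det ^ 2 = 1 := by
      have h4 : |ip (diff x p e₁) (diff x p e₁) * ip (diff x p e₂) (diff x p e₂)| = 1 := by
        rw [abs_mul, h1, h2, one_mul]
      rw [h3] at hd
      rw [hd]
      rcases eq_or_eq_neg_of_abs_eq h4 with h | h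
      -- Two vectors of equal causal type would give a determinant with square `-1`.
      · nlinarith [sq_nonneg (Matrix.of ![N p, x p, diff x p e₁, diff x p e₂]).det]
      · rw [h]; norm_num
    have h5 : orientSign x N p
        = Real.sign (Matrix.of ![N p, x p, diff x p e₁, diff x p e₂]).det := by
      rw [det_frame, sign_mul_of_pos hpos, orientSign]
    rw [h5]
    rcases sq_eq_sq_iff_eq_or_eq_neg.1 (hs.trans (one_pow 2).symm) with h | h <;> rw [h]
    · rw [Real.sign_one]
    · rw [Real.sign_of_neg (by norm_num)]
  rw [← sub_eq_zero]
  have hip (w : E42) : ip (cross ![x p, diff x p e₁, diff x p e₂] - orientSign x N p • N p) w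
      = (Matrix.of ![w, x p, diff x p e₁, diff x p e₂]).det - orientSign x N p * ip (N p) w := by
    rw [ip_sub_left, ip_cross, ip_smul_left]
  apply eq_zero_of_adapted (hx.mem p) (hN.unit p) (hN.tangent p) (hN.normal p e₁)
    (hN.normal p e₂) (ip_position_diff hx p e₁) (ip_position_diff hx p e₂) hne
  · rw [hip, hdet, hN.unit]; ring
  · rw [hip, hN.tangent, Matrix.det_zero_of_row_eq (i := 0) (j := 1) (by decide) rfl]; ring
  · rw [hip, hN.normal, Matrix.det_zero_of_row_eq (i := 0) (j := 2) (by decide) rfl]; ring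
  · rw [hip, hN.normal, Matrix.det_zero_of_row_eq (i := 0) (j := 3) (by decide) rfl]; ring

end Orientation

section FiniteType

variable {M : Type*} [TopologicalSpace M] [ChartedSpace Plane M] [IsManifold (𝓡 2) ∞ M]
  {x N : M → E42} {S : ∀ p : M, TangentSpace (𝓡 2) p →ₗ[ℝ] TangentSpace (𝓡 2) p}

/-! ### Eigenmaps built from the position vector and the normal -/

lemma orientSign_ne_zero (hM : IsOrientedAtlas M) (hx : IsLorentzianSurface x)
    (hN : IsUnitNormal x N) (p : M) : orientSign x N p ≠ 0 := by
  rcases (frameDet_ne_zero hM hx hN p).lt_or_gt with h | h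
  · simp [orientSign, Real.sign_of_neg h]
  · simp [orientSign, Real.sign_of_pos h]

/-- Near each point the sign agrees with a constant, so it affects neither smoothness nor, below,
the Laplacian. -/
lemma contMDiff_orientSign_mul (hM : IsOrientedAtlas M) (hx : IsLorentzianSurface x)
    (hN : IsUnitNormal x N) {f : M → ℝ} (hf : ContMDiff (𝓡 2) 𝓘(ℝ, ℝ) ∞ f) :
    ContMDiff (𝓡 2) 𝓘(ℝ, ℝ) ∞ (fun q => orientSign x N q * f q) := by
  intro p
  have h1 : ContMDiffAt (𝓡 2) 𝓘(ℝ, ℝ) ∞ (fun q => orientSign x N p * f q) p :=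
    contMDiffAt_const.mul (hf p)
  refine h1.congr_of_eventuallyEq ?_
  filter_upwards [orientSign_eventuallyEq hM hx hN p] with q hq
  rw [hq]

lemma laplacian_orientSign_mul (hM : IsOrientedAtlas M) (hx : IsLorentzianSurface x)
    (hN : IsUnitNormal x N) {f : M → ℝ} (hf : ContMDiff (𝓡 2) 𝓘(ℝ, ℝ) ∞ f) (p : M) :
    laplacian x (fun q => orientSign x N q * f q) p = orientSign x N p * laplacian x f p := by
  rw [← laplacian_const_mul hf]
  refine laplacian_congr ?_
  filter_upwards [orientSign_eventuallyEq hM hx hN p] with q hq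
  rw [hq]

omit [IsManifold (𝓡 2) ∞ M] in
lemma contMDiff_const_mul {f : M → ℝ} (hf : ContMDiff (𝓡 2) 𝓘(ℝ, ℝ) ∞ f) (c : ℝ) :
    ContMDiff (𝓡 2) 𝓘(ℝ, ℝ) ∞ (fun q => c * f q) :=
  contMDiff_const.mul hf

omit [IsManifold (𝓡 2) ∞ M] in
lemma contMDiff_fun_add {f g : M → ℝ} (hf : ContMDiff (𝓡 2) 𝓘(ℝ, ℝ) ∞ f)
    (hg : ContMDiff (𝓡 2) 𝓘(ℝ, ℝ) ∞ g) : ContMDiff (𝓡 2) 𝓘(ℝ, ℝ) ∞ (fun q => f q + g q) :=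
  hf.add hg

omit [IsManifold (𝓡 2) ∞ M] in
lemma contMDiff_clm_comp {f : M → E42} (hf : ContMDiff (𝓡 2) 𝓘(ℝ, E42) ∞ f) (l : E42 →L[ℝ] ℝ) :
    ContMDiff (𝓡 2) 𝓘(ℝ, ℝ) ∞ (fun q => l (f q)) :=
  l.contDiff.contMDiff.comp hf

omit [IsManifold (𝓡 2) ∞ M] in
lemma diff_combination_of_const (hx : IsLorentzianSurface x) (hN : IsUnitNormal x N) {p : M}
    {a : ℝ} {L : E42 →L[ℝ] E42} {w : E42} (h : ∀ᶠ q in nhds p, a • N q + L (x q) = w)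
    (v : TangentSpace (𝓡 2) p) : a • diff N p v + L (diff x p v) = 0 := by
  have hxd : MDifferentiableAt (𝓡 2) 𝓘(ℝ, E42) x p := hx.smooth.mdifferentiableAt (by simp)
  have hNd : MDifferentiableAt (𝓡 2) 𝓘(ℝ, E42) N p := hN.smooth.mdifferentiableAt (by simp)
  obtain ⟨A, hA⟩ : ∃ A : TangentSpace (𝓡 2) p →L[ℝ] E42, HasMFDerivAt (𝓡 2) 𝓘(ℝ, E42) N p A :=
    ⟨_, hNd.hasMFDerivAt⟩
  obtain ⟨B, hB⟩ : ∃ B : TangentSpace (𝓡 2) p →L[ℝ] E42, HasMFDerivAt (𝓡 2) 𝓘(ℝ, E42) x p B :=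
    ⟨_, hxd.hasMFDerivAt⟩
  have h1 : HasMFDerivAt (𝓡 2) 𝓘(ℝ, E42) (a • N + L ∘ x) p (a • A + L.comp B) :=
    (hA.const_smul a).add (L.hasFDerivAt.hasMFDerivAt.comp p hB)
  have h2 : HasMFDerivAt (𝓡 2) 𝓘(ℝ, E42) (a • N + L ∘ x) p
      (0 : TangentSpace (𝓡 2) p →L[ℝ] E42) :=
    (hasMFDerivAt_const w p).congr_of_eventuallyEq h
  have h3 := congrArg (fun A : TangentSpace (𝓡 2) p →L[ℝ] E42 => A v) (hasMFDerivAt_unique h1 h2)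
  have hA' : diff N p v = A v := congrArg (fun A : TangentSpace (𝓡 2) p →L[ℝ] E42 => A v) hA.mfderiv
  have hB' : diff x p v = B v := congrArg (fun A : TangentSpace (𝓡 2) p →L[ℝ] E42 => A v) hB.mfderiv
  rw [hA', hB']
  exact h3

omit [IsManifold (𝓡 2) ∞ M] in
-- Differentiating `a N + b x = w` gives `S = (b / a) id` at `p`. This is what shows that the
-- spectral components are not constant.
lemma isDiagonalizable_of_combination_const (hx : IsLorentzianSurface x) (hN : IsUnitNormal x N)
    (hS : IsShapeOperator x N S) {p : M} {a b : ℝ} (ha : a ≠ 0) {w : E42}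
    (h : ∀ᶠ q in nhds p, a • N q + b • x q = w) : IsDiagonalizable (S p) := by
  have h4 (v : TangentSpace (𝓡 2) p) : a • diff N p v + b • diff x p v = 0 :=
    diff_combination_of_const hx hN (L := b • ContinuousLinearMap.id ℝ E42) h v
  have h5 (v : TangentSpace (𝓡 2) p) : S p v = (b / a) • v := by
    apply hx.immersion p
    have e : diff x p ((b / a) • v) = (b / a) • diff x p v := (diffL x p).map_smul _ _
    rw [e, hS]
    have h6 := h4 v
    rw [add_eq_zero_iff_eq_neg] at h6
    have h7 : diff N p v = a⁻¹ • (a • diff N p v) := by rw [smul_smul, inv_mul_cancel₀ ha, one_smul]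
    rw [h7, h6]
    module
  rw [IsDiagonalizable, eq_top_iff]
  intro v _
  exact Submodule.mem_iSup_of_mem (b / a) (Module.End.mem_eigenspace_iff.2 (h5 v))

/-- Combinations of the oriented unit normal and the position vector are eigenmaps as soon as
their coefficients form an eigenvector of the matrix of the Laplacian. -/
lemma isEigenmap_combination (hM : IsOrientedAtlas M) (hx : IsLorentzianSurface x)
    (hN : IsUnitNormal x N) (hS : IsShapeOperator x N S) {h d : ℝ}
    (hh : ∀ p, meanCurvature S p = h) (hd : ∀ p, LinearMap.det (S p) = d)
    (hdiag : ∃ p, ¬ IsDiagonalizable (S p)) {a b c : ℝ} (ha : a ≠ 0)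
    (h1 : (4 * h ^ 2 - 2 * d) * a - 2 * h * b = c * a) (h2 : 2 * h * a - 2 * b = c * b) :
    IsEigenmap x c (fun p => orientSign x N p • hodgeStar (a • N p + b • x p)) := by
  have key (ℓ : Module.Dual ℝ (⋀[ℝ]^3 E42)) : ∃ l : E42 →L[ℝ] ℝ, ∀ p,
      ℓ (orientSign x N p • hodgeStar (a • N p + b • x p))
        = orientSign x N p * (a * l (N p) + b * l (x p)) :=
    ⟨LinearMap.toContinuousLinearMap (ℓ ∘ₗ hodgeStar.toLinearMap), fun p => by simp [mul_add]⟩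
  have hsm (l : E42 →L[ℝ] ℝ) : ContMDiff (𝓡 2) 𝓘(ℝ, ℝ) ∞ fun q => a * l (N q) + b * l (x q) :=
    contMDiff_fun_add (contMDiff_const_mul (contMDiff_clm_comp hN.smooth l) _)
      (contMDiff_const_mul (contMDiff_clm_comp hx.smooth l) _)
  refine ⟨fun ℓ => ?_, ?_, fun ℓ p => ?_⟩
  · obtain ⟨l, hl⟩ := key ℓ
    simp only [hl]
    exact contMDiff_orientSign_mul hM hx hN (hsm l)
  · rintro ⟨v, hv⟩
    obtain ⟨p, hp⟩ := hdiag
    refine hp (isDiagonalizable_of_combination_const hx hN hS (b := b) ha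
      (w := hodgeStar.symm ((orientSign x N p)⁻¹ • v)) ?_)
    filter_upwards [orientSign_eventuallyEq hM hx hN p] with q hq
    rw [← hv q, hq, smul_smul, inv_mul_cancel₀ (orientSign_ne_zero hM hx hN p), one_smul,
      LinearEquiv.symm_apply_apply]
  · obtain ⟨l, hl⟩ := key ℓ
    simp only [hl]
    rw [laplacian_orientSign_mul hM hx hN (hsm l),
      laplacian_add (contMDiff_const_mul (contMDiff_clm_comp hN.smooth l) _)
        (contMDiff_const_mul (contMDiff_clm_comp hx.smooth l) _),
      laplacian_const_mul (contMDiff_clm_comp hN.smooth l),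
      laplacian_const_mul (contMDiff_clm_comp hx.smooth l), laplacian_position hx hN hS,
      laplacian_normal hx hN hS hh, hh, hd]
    linear_combination orientSign x N p * l (N p) * h1 + orientSign x N p * l (x p) * h2

/-! ### Maps of infinite type -/

/-- A finite sum of eigenfunctions annihilated by `Δ² + A Δ + B` is annihilated by the Laplacian
if zero is the only possible real root of `T² + A T + B`. -/
lemma laplacian_eq_zero_of_finite_sum {k : ℕ} {c : Fin k → ℝ} {f : Fin k → M → ℝ}
    (hf : ∀ i, ContMDiff (𝓡 2) 𝓘(ℝ, ℝ) ∞ (f i)) (he : ∀ i p, laplacian x (f i) p = c i * f i p)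
    {A B : ℝ} (hQ : ∀ t : ℝ, t ^ 2 + A * t + B = 0 → t = 0)
    (hsum : ∀ p, ∑ i, (c i ^ 2 + A * c i + B) * f i p = 0) (p : M) :
    ∑ i, c i * f i p = 0 := by
  have hcm (a : Fin k → ℝ) (i) : ContMDiff (𝓡 2) 𝓘(ℝ, ℝ) ∞ fun p => a i * f i p :=
    contMDiff_const.mul (hf i)
  -- Applying the Laplacian repeatedly multiplies each term by its eigenvalue, so the relation
  -- persists with any polynomial in `c i` as an extra factor.
  have hpow (m : ℕ) : ∀ p, ∑ i, c i ^ m * (c i ^ 2 + A * c i + B) * f i p = 0 := by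
    induction m with
    | zero => simpa using hsum
    | succ m ih =>
      intro p
      have h1 : laplacian x (fun q => ∑ i, c i ^ m * (c i ^ 2 + A * c i + B) * f i q) p = 0 := by
        simp only [ih]
        exact laplacian_zero p
      rw [laplacian_sum Finset.univ (hcm fun i => c i ^ m * (c i ^ 2 + A * c i + B))] at h1
      rw [← h1]
      refine Finset.sum_congr rfl fun i _ => ?_
      rw [laplacian_const_mul (hf i), he]
      ring
  have hpoly (R : Polynomial ℝ) :
      ∑ i, R.eval (c i) * (c i ^ 2 + A * c i + B) * f i p = 0 := by
    simp only [Polynomial.eval_eq_sum_range, Finset.sum_mul]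
    rw [Finset.sum_comm]
    refine Finset.sum_eq_zero fun m _ => ?_
    have := hpow m p
    rw [← mul_zero (R.coeff m), ← this, Finset.mul_sum]
    exact Finset.sum_congr rfl fun i _ => by ring
  -- With `Q = T² + A T + B`, choose `R` so that `R(c) Q(c) = c` at every eigenvalue `c`. This is
  -- possible because `Q(c) = 0` forces `c = 0`. The eigenvalues may repeat, hence the image as node
  -- set.
  rw [← hpoly (Lagrange.interpolate (Finset.univ.image c) id
    fun t => t * (t ^ 2 + A * t + B)⁻¹)]
  refine Finset.sum_congr rfl fun i _ => ?_
  have := Lagrange.eval_interpolate_at_node (s := Finset.univ.image c) (v := id)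
    (fun t => t * (t ^ 2 + A * t + B)⁻¹) (Set.injOn_id _)
    (Finset.mem_image_of_mem c (Finset.mem_univ i))
  rw [id] at this
  rw [this]
  by_cases h0 : c i = 0
  · simp [h0]
  · have : c i ^ 2 + A * c i + B ≠ 0 := fun h => h0 (hQ _ h)
    rw [mul_assoc (c i), inv_mul_cancel₀ this, mul_one]

/-- The Gauss map of a flat surface of constant nonzero mean curvature, whose shape operator has
nonpositive discriminant, is of infinite type. -/
lemma isInfiniteType_of_flat (hM : IsOrientedAtlas M) (hx : IsLorentzianSurface x)
    (hN : IsUnitNormal x N) (hS : IsShapeOperator x N S) {h : ℝ}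
    (hh : ∀ p, meanCurvature S p = h) (hd : ∀ p, LinearMap.det (S p) = 1) (h0 : h ≠ 0)
    (h1 : h ^ 2 ≤ 1) [Nonempty M] {ν : M → ⋀[ℝ]^3 E42} (hν : IsGaussMap x ν) :
    IsInfiniteType x ν := by
  rintro ⟨k, c, ψ, -, hψ, hsum⟩
  obtain ⟨p⟩ := ‹Nonempty M›
  -- The functional is chosen to vanish on `N p` but not on `x p`, so that it detects the term `2h
  -- x` of `ΔN` at `p`.
  set l : E42 →L[ℝ] ℝ := ipL (x p) with hl
  set ℓ : Module.Dual ℝ (⋀[ℝ]^3 E42) := l.toLinearMap ∘ₗ hodgeStar.symm.toLinearMap with hℓ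
  set f : Fin k → M → ℝ := fun i q => ℓ (ψ i q) with hf
  have hfs (i) : ContMDiff (𝓡 2) 𝓘(ℝ, ℝ) ∞ (f i) := (hψ i).smooth ℓ
  have hfe (i q) : laplacian x (f i) q = c i * f i q := (hψ i).eigen ℓ q
  have hF (q) : ∑ i, f i q = orientSign x N q * l (N q) := by
    have := congrArg ℓ (hsum q)
    rw [gaussMap_eq hx hN hν, map_sum] at this
    rw [← this, hℓ]
    simp
  have hlN := contMDiff_clm_comp hN.smooth l
  have hlx := contMDiff_clm_comp hx.smooth l
  have hΔ (a : Fin k → ℝ) (q) : laplacian x (fun q => ∑ i, a i * f i q) q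
      = ∑ i, c i * (a i * f i q) := by
    rw [laplacian_sum Finset.univ fun i => contMDiff_const_mul (hfs i) _]
    refine Finset.sum_congr rfl fun i _ => ?_
    rw [laplacian_const_mul (hfs i), hfe]
    ring
  have hF1 (q) : ∑ i, c i * f i q
      = orientSign x N q * ((4 * h ^ 2 - 2) * l (N q) + 2 * h * l (x q)) := by
    have e := hΔ (fun _ => 1) q
    simp only [one_mul, hF] at e
    rw [← e, laplacian_orientSign_mul hM hx hN hlN, laplacian_normal hx hN hS hh, hd, mul_one]
  have hF2 (q) : ∑ i, c i * (c i * f i q) = orientSign x N q *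
      ((4 * h ^ 2 - 2) * ((4 * h ^ 2 - 2) * l (N q) + 2 * h * l (x q))
        + 2 * h * (-2 * h * l (N q) - 2 * l (x q))) := by
    rw [← hΔ c q]
    simp only [hF1]
    rw [laplacian_orientSign_mul hM hx hN
      (contMDiff_fun_add (contMDiff_const_mul hlN _) (contMDiff_const_mul hlx _)),
      laplacian_add (contMDiff_const_mul hlN _) (contMDiff_const_mul hlx _),
      laplacian_const_mul hlN, laplacian_const_mul hlx, laplacian_normal hx hN hS hh, hd, mul_one,
      laplacian_position hx hN hS, hh]
  -- `A` and `B` are the coefficients of the characteristic polynomial for `d = 1`. Completing the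
  -- square leaves `4(1 - h²)h² ≥ 0`, so a real root requires `h² = 1`, and then the polynomial is
  -- `T²`.
  have key := laplacian_eq_zero_of_finite_sum hfs hfe (A := 4 - 4 * h ^ 2) (B := 4 - 4 * h ^ 2)
    (fun t ht => by
      have h2 : (t + 2 * (1 - h ^ 2)) ^ 2 + 4 * ((1 - h ^ 2) * h ^ 2) = 0 := by linarith
      have h3 : 0 ≤ (1 - h ^ 2) * h ^ 2 := mul_nonneg (by linarith) (sq_nonneg h)
      have h4 : (1 - h ^ 2) * h ^ 2 = 0 := by nlinarith [sq_nonneg (t + 2 * (1 - h ^ 2))]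
      have h5 : 1 - h ^ 2 = 0 := (mul_eq_zero.1 h4).resolve_right (pow_ne_zero 2 h0)
      rw [h5] at h2
      simpa using h2)
    (fun q => by
      have e : ∀ i, (c i ^ 2 + (4 - 4 * h ^ 2) * c i + (4 - 4 * h ^ 2)) * f i q
          = c i * (c i * f i q) + (4 - 4 * h ^ 2) * (c i * f i q) + (4 - 4 * h ^ 2) * f i q :=
        fun i => by ring
      simp only [e, Finset.sum_add_distrib, ← Finset.mul_sum]
      rw [hF2, hF1, hF]
      ring) p
  rw [hF1] at key
  have e1 : l (N p) = 0 := by rw [hl, ipL_apply, ip_comm, hN.tangent]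
  have e2 : l (x p) = -1 := hx.mem p
  rw [e1, e2] at key
  have := (mul_eq_zero.1 key).resolve_left (orientSign_ne_zero hM hx hN p)
  apply h0
  linarith

end FiniteType

/-! ### Complex circles -/

/-- Multiplication by `i` in the identification `ℂ² = 𝔼⁴₂`. -/
def mulI : E42 →L[ℝ] E42 :=
  LinearMap.toContinuousLinearMap
    { toFun := fun v => ![v 2, v 3, -v 0, -v 1]
      map_add' := fun v w => by
        ext i; fin_cases i <;> simp [add_comm]
      map_smul' := fun c v => by
        ext i; fin_cases i <;> simp }

lemma mulI_apply (v : E42) : mulI v = ![v 2, v 3, -v 0, -v 1] := rfl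

lemma mulI_mulI (v : E42) : mulI (mulI v) = -v := by
  ext i; fin_cases i <;> simp [mulI_apply]

lemma ip_mulI (v w : E42) : ip (mulI v) w = ip v (mulI w) := by
  simp [ip, mulI_apply]; ring

lemma ip_mulI_mulI (v w : E42) : ip (mulI v) (mulI w) = -ip v w := by
  rw [ip_mulI, mulI_mulI, ip_neg_right]

/-- `⟨iz, z⟩ = Re (i (z₁² + z₂²))`, the half of the defining equation not already contained in `ip v
v = -1`. -/
lemma mem_complexCircle {κ : ℂ} {v : E42} (hv : v ∈ complexCircle κ) :
    ip (mulI v) v = -κ.im := by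
  have h := congrArg Complex.im hv
  simp only [pow_two, Complex.add_im, Complex.mul_im] at h
  simp [ip, mulI_apply]
  linarith

/-- Invariants of an operator `S` on a real plane such that `b - a S` squares to `-1`. -/
lemma trace_det_of_complex_structure {V : Type*} [AddCommGroup V] [Module ℝ V]
    (e : Module.Basis (Fin 2) ℝ V) {T : V →ₗ[ℝ] V} {a b : ℝ} (ha : a ≠ 0)
    (hT : ∀ v, b • (b • v - a • T v) - a • T (b • v - a • T v) = -v) :
    a * LinearMap.trace ℝ V T = 2 * b ∧ a ^ 2 * LinearMap.det T = b ^ 2 + 1 := by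
  obtain ⟨m, h⟩ : ∃ m : Fin 2 → Fin 2 → ℝ, ∀ i, T (e i) = ∑ k, m k i • e k :=
    ⟨fun k i => e.repr (T (e i)) k, fun i => (e.sum_repr (T (e i))).symm⟩
  obtain ⟨h1, h2⟩ := trace_det_of_basis e T h
  have key (i k) := congrArg (fun v => e.repr v k) (hT (e i))
  simp only [Fin.sum_univ_two] at h
  have k00 := key 0 0
  have k01 := key 0 1
  have k11 := key 1 1
  have k10 := key 1 0
  simp [h] at k00 k01 k10 k11
  -- Otherwise `J = b - a T` is triangular, and a real diagonal entry would square to `-1`. The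
  -- off-diagonal entry of `J² = -1` then gives `tr J = 0`.
  have hne : m 0 1 ≠ 0 := by
    intro h0
    rw [h0] at k00
    nlinarith [sq_nonneg (b - a * m 0 0)]
  have ht : a * (m 0 0 + m 1 1) = 2 * b := by
    have : a * m 0 1 * (a * (m 0 0 + m 1 1) - 2 * b) = 0 := by linarith
    have := (mul_eq_zero.1 this).resolve_left (mul_ne_zero ha hne)
    linarith
  rw [h1, h2]
  refine ⟨ht, ?_⟩
  have : a * m 1 1 = 2 * b - a * m 0 0 := by linarith
  linear_combination -k00 + (a * m 0 0) * this

section ComplexCircle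

variable {M : Type*} [TopologicalSpace M] [ChartedSpace Plane M]
  {x N : M → E42} {S : ∀ p : M, TangentSpace (𝓡 2) p →ₗ[ℝ] TangentSpace (𝓡 2) p}

lemma exists_basis_tangentSpace (p : M) :
    Nonempty (Module.Basis (Fin 2) ℝ (TangentSpace (𝓡 2) p)) :=
  ⟨(EuclideanSpace.basisFun (Fin 2) ℝ).toBasis⟩

lemma eq_zero_of_orthogonal (hx : IsLorentzianSurface x) (hN : IsUnitNormal x N) {p : M} {w : E42}
    (h1 : ip w (N p) = 0) (h2 : ip w (x p) = 0) (h3 : ∀ v, ip w (diff x p v) = 0) : w = 0 := by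
  obtain ⟨e₁, e₂, h11, h22, h12⟩ := hx.lorentzian p
  simp only [inducedMetric] at h11 h22 h12
  exact eq_zero_of_adapted (hx.mem p) (hN.unit p) (hN.tangent p) (hN.normal p e₁)
    (hN.normal p e₂) (ip_position_diff hx p e₁) (ip_position_diff hx p e₂)
    (by rw [h11, h22, h12]; norm_num) h1 h2 (h3 e₁) (h3 e₂)

/-- The invariants of the shape operator of a complex circle. -/
lemma trace_det_of_isComplexCircle (hx : IsLorentzianSurface x) (hN : IsUnitNormal x N)
    (hS : IsShapeOperator x N S) {κ : ℂ} (hκ : IsComplexCircle x κ) (p : M) :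
    LinearMap.det (S p) = 1 ∧ (meanCurvature S p = 0 ↔ κ.im = 0) := by
  obtain ⟨e⟩ := exists_basis_tangentSpace p
  have hmem (q : M) : ip (mulI (x q)) (x q) = -κ.im :=
    mem_complexCircle (hκ.2 ▸ Set.mem_range_self q)
  -- Differentiate the constant `⟨ix, x⟩`; multiplication by `i` is self-adjoint, so both terms
  -- agree.
  have htan (q : M) (v : TangentSpace (𝓡 2) q) : ip (mulI (x q)) (diff x q v) = 0 := by
    have h := apply_diff_of_comp_const (hx.smooth.mdifferentiableAt (by simp))
      (ipL.hasFDerivAt_of_bilinear mulI.hasFDerivAt (hasFDerivAt_id (x q)))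
      (c := -κ.im) (fun r => hmem r) v
    simp [ip_mulI (diff x q v), ip_comm (diff x q v)] at h
    linarith
  -- `i x` is a combination of the normal vectors `N` and `x`
  have hJ (q : M) : ip (N q) (mulI (x q)) • N q + (κ.im • x q - mulI (x q)) = 0 := by
    apply eq_zero_of_orthogonal hx hN (p := q)
    · simp only [ip_add_left, ip_sub_left, ip_smul_left, hN.unit, ip_comm (x q), hN.tangent,
        ip_comm (mulI (x q))]
      ring
    · simp only [ip_add_left, ip_sub_left, ip_smul_left, hN.tangent, hmem]
      rw [hx.mem q]; ring
    · intro v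
      simp only [ip_add_left, ip_sub_left, ip_smul_left, hN.normal, ip_position_diff hx, htan]
      ring
  have hsq (q : M) : ip (N q) (mulI (x q)) ^ 2 = 1 + κ.im ^ 2 := by
    have h1 := congrArg (fun w => ip w (mulI (x q))) (hJ q)
    simp only [ip_add_left, ip_sub_left, ip_smul_left, ip_zero_left, ip_mulI_mulI] at h1
    rw [ip_comm (x q), hmem, hx.mem q] at h1
    linarith
  set a := ip (N p) (mulI (x p)) with ha
  have ha0 : a ≠ 0 := fun h0 => by
    have := hsq p
    rw [← ha, h0] at this
    nlinarith [sq_nonneg κ.im]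
  have hcont : Continuous fun q => ip (N q) (mulI (x q)) :=
    ((ipL.continuous.comp hN.smooth.continuous).clm_apply
      (mulI.continuous.comp hx.smooth.continuous))
  -- By `hsq` the coefficient takes only two opposite nonzero values, so continuity makes it locally
  -- constant.
  have hev : ∀ᶠ q in nhds p, ip (N q) (mulI (x q)) = a := by
    have hs : ContinuousAt (fun q => ip (N q) (mulI (x q)) * a) p :=
      (hcont.mul continuous_const).continuousAt
    have hpos : 0 < ip (N p) (mulI (x p)) * a := mul_self_pos.2 ha0
    filter_upwards [hs.eventually (lt_mem_nhds hpos)] with q hq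
    rcases sq_eq_sq_iff_eq_or_eq_neg.1 ((hsq q).trans (hsq p).symm) with h | h
    · exact h
    · rw [h] at hq
      nlinarith [mul_self_pos.2 ha0]
  have hd (v) : a • diff N p v + (κ.im • diff x p v - mulI (diff x p v)) = 0 := by
    refine diff_combination_of_const hx hN
      (L := κ.im • ContinuousLinearMap.id ℝ E42 - mulI) (w := 0) ?_ v
    filter_upwards [hev] with q hq
    rw [← hq]
    exact hJ q
  -- Differentiating `a N = i x - (Im κ) x` shows that `i` acts on the tangent plane as `Im κ - a
  -- S`, an operator with square `-1`.
  have hcs (v) : mulI (diff x p v) = diff x p (κ.im • v - a • S p v) := by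
    have e1 : diff x p (κ.im • v - a • S p v) = κ.im • diff x p v - a • diff x p (S p v) := by
      simp only [← diffL_apply, map_sub, map_smul]
    rw [e1, hS, ← sub_eq_zero, ← neg_eq_zero, ← hd v]
    module
  obtain ⟨h1, h2⟩ := trace_det_of_complex_structure e (T := S p) ha0 (b := κ.im) fun v => by
    apply hx.immersion p
    have e1 : diff x p (-v) = -diff x p v := (diffL x p).map_neg v
    have h3 := hcs (κ.im • v - a • S p v)
    rw [← hcs v, mulI_mulI, map_sub, map_smul, map_smul] at h3
    rw [e1, h3, map_sub, map_smul, map_smul]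
  constructor
  · have := hsq p
    rw [← ha] at this
    rw [this] at h2
    have h3 : 1 + κ.im ^ 2 ≠ 0 := by positivity
    exact mul_left_cancel₀ h3 (by rw [h2]; ring)
  · rw [meanCurvature]
    constructor
    · intro h
      have : LinearMap.trace ℝ _ (S p) = 0 := by linarith
      rw [this] at h1
      linarith
    · intro h
      rw [h, mul_zero] at h1
      rw [(mul_eq_zero.1 h1).resolve_left ha0, zero_div]

end ComplexCircle

/-! ### B-scrolls -/

/-- Allows curves parametrized by the subtype `I` to be differentiated in a real variable. -/
lemma exists_local_section (I : TopologicalSpace.Opens ℝ) (s : I) :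
    ∃ r : ℝ → I, r s = s ∧ MDifferentiableAt 𝓘(ℝ, ℝ) 𝓘(ℝ, ℝ) r s ∧
      ∀ᶠ u in nhds (s : ℝ), (r u : ℝ) = u := by
  refine ⟨(chartAt ℝ s).symm, ?_, ?_, ?_⟩
  · exact (chartAt ℝ s).left_inv (mem_chart_source ℝ s)
  · exact (mdifferentiable_chart s).symm.mdifferentiableAt (mem_chart_target ℝ s)
  · filter_upwards [TopologicalSpace.Opens.chartAt_subtype_val_symm_eventuallyEq (H := ℝ) I (x := s)]
      with u hu
    exact hu.symm

section BScroll

variable {M : Type*} [TopologicalSpace M] [ChartedSpace Plane M]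
  {x N : M → E42} {S : ∀ p : M, TangentSpace (𝓡 2) p →ₗ[ℝ] TangentSpace (𝓡 2) p}

/-- One tangent vector serves for all `f`; it is applied to both `x` and `N` to relate their
derivatives through the shape operator. -/
lemma exists_velocity {c : ℝ → M} {u : ℝ} {p : M} (hp : c u = p)
    (hc : MDifferentiableAt 𝓘(ℝ, ℝ) (𝓡 2) c u) :
    ∃ v : TangentSpace (𝓡 2) p, ∀ f : M → E42, ContMDiff (𝓡 2) 𝓘(ℝ, E42) ∞ f →
      HasDerivAt (fun r => f (c r)) (diff f p v) u := by
  subst hp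
  refine ⟨mfderiv 𝓘(ℝ, ℝ) (𝓡 2) c u (1 : ℝ), fun f hf => ?_⟩
  have h1 := ((hf.mdifferentiableAt (x := c u) (by simp)).comp u hc).differentiableAt.hasDerivAt
  have h2 : deriv (f ∘ c) u = diff f (c u) (mfderiv 𝓘(ℝ, ℝ) (𝓡 2) c u (1 : ℝ)) := by
    rw [← fderiv_apply_one_eq_deriv, ← mfderiv_eq_fderiv,
      mfderiv_comp u (hf.mdifferentiableAt (by simp)) hc]
    rfl
  rw [← h2]
  exact h1

lemma exists_coordinate_velocities {I : TopologicalSpace.Opens ℝ}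
    (Φ : (I × ℝ) ≃ₘ⟮𝓘(ℝ, ℝ).prod 𝓘(ℝ, ℝ), 𝓡 2⟯ M) (s : I) (t : ℝ) :
    (∃ v : TangentSpace (𝓡 2) (Φ (s, t)), ∀ f : M → E42, ContMDiff (𝓡 2) 𝓘(ℝ, E42) ∞ f →
      ∀ g : ℝ → E42, (∀ r : I, f (Φ (r, t)) = g r) → HasDerivAt g (diff f _ v) s) ∧
    (∃ v : TangentSpace (𝓡 2) (Φ (s, t)), ∀ f : M → E42, ContMDiff (𝓡 2) 𝓘(ℝ, E42) ∞ f →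
      HasDerivAt (fun r => f (Φ (s, r))) (diff f _ v) t) := by
  have hΦ (z) : MDifferentiableAt (𝓘(ℝ, ℝ).prod 𝓘(ℝ, ℝ)) (𝓡 2) Φ z :=
    Φ.contMDiff.mdifferentiableAt (by simp)
  constructor
  · obtain ⟨r, hr, hr', hr''⟩ := exists_local_section I s
    have hc : MDifferentiableAt 𝓘(ℝ, ℝ) (𝓡 2) (fun u => Φ (r u, t)) (s : ℝ) :=
      (hΦ _).comp (s : ℝ) (hr'.prodMk mdifferentiableAt_const)
    obtain ⟨v, hv⟩ := exists_velocity (p := Φ (s, t)) (by simp only [hr]) hc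
    refine ⟨v, fun f hf g hg => (hv f hf).congr_of_eventuallyEq ?_⟩
    filter_upwards [hr''] with u hu
    rw [hg, hu]
  · have hc : MDifferentiableAt 𝓘(ℝ, ℝ) (𝓡 2) (fun u => Φ (s, u)) t :=
      (hΦ _).comp t (mdifferentiableAt_const.prodMk mdifferentiableAt_id)
    exact exists_velocity rfl hc

/-- The invariants of the shape operator of a B-scroll. -/
lemma trace_det_of_isBScroll (hx : IsLorentzianSurface x) (hN : IsUnitNormal x N)
    (hS : IsShapeOperator x N S) (hB : IsBScroll x) :
    ∃ p, LinearMap.det (S p) = meanCurvature S p ^ 2 ∧ meanCurvature S p ≠ 0 := by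
  obtain ⟨I, γ, A, B, C, k₁, k₂, Φ, hI, hF, hΦ⟩ := hB
  obtain ⟨s, hs⟩ := hI.nonempty
  lift s to I using hs
  -- derivatives of the parametrization
  have hxs (r : I) (t : ℝ) : HasDerivAt (fun u => γ u + t • B u)
      (A r + t • (k₂ • C r - γ r)) r :=
    (hF.deriv_γ r r.2).add ((hF.deriv_B r r.2).const_smul t)
  have hxt (r : I) (t : ℝ) : HasDerivAt (fun u : ℝ => x (Φ (r, u))) (B r) t := by
    simp only [hΦ]
    simpa using ((hasDerivAt_id t).smul_const (B r)).const_add (γ r)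
  have hNs (r : I) (t : ℝ) : ip (N (Φ (r, t))) (A r + t • (k₂ • C r - γ r)) = 0 := by
    obtain ⟨⟨v, hv⟩, -⟩ := exists_coordinate_velocities Φ r t
    rw [(hxs r t).unique (hv x hx.smooth _ fun u => hΦ u t), hN.normal]
  have hNt (r : I) (t : ℝ) : ip (N (Φ (r, t))) (B r) = 0 := by
    obtain ⟨-, ⟨v, hv⟩⟩ := exists_coordinate_velocities Φ r t
    rw [(hxt r t).unique (hv x hx.smooth), hN.normal]
  obtain ⟨⟨vs, hvs⟩, ⟨vt, hvt⟩⟩ := exists_coordinate_velocities Φ s 0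
  refine ⟨Φ (s, 0), ?_⟩
  have hAs : diff x (Φ (s, 0)) vs = A s := by
    rw [← (hxs s 0).unique (hvs x hx.smooth _ fun u => hΦ u 0)]
    simp
  have hBt : diff x (Φ (s, 0)) vt = B s := ((hxt s 0).unique (hvt x hx.smooth)).symm
  obtain ⟨hAA, hBB⟩ := hF.null s s.2
  have hAB := hF.pairing s s.2
  obtain ⟨hCC, hAC, hBC⟩ := hF.spacelike s s.2
  obtain ⟨hγA, hγB, hγC⟩ := hF.tangent s s.2
  have hγ : ip (γ s) (γ s) = -1 := hF.mem s s.2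
  have hxp : x (Φ (s, 0)) = γ s := by simp [hΦ]
  have hNγ : ip (N (Φ (s, 0))) (γ s) = 0 := hxp ▸ hN.tangent _
  have hNA : ip (N (Φ (s, 0))) (A s) = 0 := hAs ▸ hN.normal _ vs
  have hNB : ip (N (Φ (s, 0))) (B s) = 0 := hNt s 0
  -- `N` is orthogonal to `γ`, `A` and `B` at `t = 0`, hence a multiple of `C`; only `ε ≠ 0` is
  -- needed.
  set ε := ip (N (Φ (s, 0))) (C s) with hε
  have hε0 : ε ≠ 0 := by
    intro h0
    have hN0 : N (Φ (s, 0)) = 0 :=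
      eq_zero_of_adapted hγ hCC (by rw [ip_comm, hγC]) (by rw [ip_comm, hAC])
        (by rw [ip_comm, hBC]) hγA hγB (by rw [hAA, hBB, hAB]; norm_num) h0 hNγ hNA hNB
    have := hN.unit (Φ (s, 0))
    rw [hN0, ip_zero_left] at this
    norm_num at this
  -- derivatives of the orthogonality relations
  have e1 : ip (diff N _ vt) (B s) = 0 := by
    have h1 := (((ipL.flip (B s)).hasFDerivAt).comp_hasDerivAt (0 : ℝ) (hvt N hN.smooth))
    have h2 : HasDerivAt (fun _ : ℝ => (0 : ℝ)) 0 0 := hasDerivAt_const _ _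
    exact h1.unique (h2.congr_of_eventuallyEq (.of_forall fun t => hNt s t))
  have e2 : ip (diff N _ vt) (A s) + k₂ * ε = 0 := by
    have h0 : HasDerivAt (fun t : ℝ => A s + t • (k₂ • C s - γ s)) (k₂ • C s - γ s) 0 := by
      simpa using ((hasDerivAt_id (0 : ℝ)).smul_const (k₂ • C s - γ s)).const_add (A s)
    have h1 := (ipL.hasFDerivAt.comp_hasDerivAt (0 : ℝ) (hvt N hN.smooth)).clm_apply h0
    have h2 : HasDerivAt (fun _ : ℝ => (0 : ℝ)) 0 0 := hasDerivAt_const _ _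
    have h3 := h1.unique (h2.congr_of_eventuallyEq (.of_forall fun t => hNs s t))
    simp [ip_sub_right, ip_smul_right, hNγ, ← hε] at h3
    linarith
  have e3 : ip (diff N _ vs) (B s) + k₂ * ε = 0 := by
    -- `N ∘ Φ` is defined only for parameters in `I`; the extension by zero does not affect
    -- derivatives at `s`.
    obtain ⟨g, hg⟩ : ∃ g : ℝ → E42, ∀ r : I, N (Φ (r, 0)) = g r :=
      by
        classical
        exact ⟨fun u => if h : u ∈ I then N (Φ (⟨u, h⟩, 0)) else 0, fun r => by simp⟩
    have h1 := (ipL.hasFDerivAt.comp_hasDerivAt (s : ℝ) (hvs N hN.smooth g hg)).clm_apply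
      (hF.deriv_B s s.2)
    have h2 : HasDerivAt (fun _ : ℝ => (0 : ℝ)) 0 (s : ℝ) := hasDerivAt_const _ _
    have h3 := h1.unique (h2.congr_of_eventuallyEq (by
      filter_upwards [I.isOpen.mem_nhds s.2] with u hu
      have := hNt ⟨u, hu⟩ 0
      rw [hg] at this
      exact this))
    simp [ip_sub_right, ip_smul_right, ← hg, hNγ, ← hε] at h3
    linarith
  have hli : LinearIndependent ℝ ![vs, vt] := by
    rw [LinearIndependent.pair_iff]
    intro a b hab
    have h1 : a • A s + b • B s = 0 := by
      rw [← hAs, ← hBt, ← diffL_apply, ← diffL_apply, ← (diffL x _).map_smul,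
        ← (diffL x _).map_smul, ← (diffL x _).map_add, hab, map_zero]
    have h2 := congrArg (fun w => ip w (B s)) h1
    have h3 := congrArg (fun w => ip w (A s)) h1
    simp only [ip_add_left, ip_smul_left, ip_zero_left, hAB, hBB, hAA, ip_comm (B s) (A s)]
      at h2 h3
    exact ⟨by linarith, by linarith⟩
  have hfr : Module.finrank ℝ (TangentSpace (𝓡 2) (Φ (s, 0))) = 2 :=
    finrank_euclideanSpace_fin (𝕜 := ℝ) (n := 2)
  set b := basisOfLinearIndependentOfCardEqFinrank hli (by rw [hfr, Fintype.card_fin]) with hb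
  have hb0 : b 0 = vs := by simp [hb]
  have hb1 : b 1 = vt := by simp [hb]
  obtain ⟨m, hm⟩ : ∃ m : Fin 2 → Fin 2 → ℝ, ∀ i, S _ (b i) = ∑ k, m k i • b k :=
    ⟨fun k i => b.repr (S _ (b i)) k, fun i => (b.sum_repr _).symm⟩
  obtain ⟨htr, hdet⟩ := trace_det_of_basis b (S _) hm
  -- Pairing with the null vectors `A` and `B` extracts the entries of `S`. The entry `m 1 0` is not
  -- computed: `m 0 1 = 0` makes it irrelevant to trace and determinant.
  have hd (i) : m 0 i • A s + m 1 i • B s = -diff N _ (b i) := by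
    rw [← hS, hm i, Fin.sum_univ_two, hb0, hb1, ← diffL_apply, map_add, map_smul, map_smul,
      diffL_apply, diffL_apply, hAs, hBt]
  have h00 := congrArg (fun w => ip w (B s)) (hd 0)
  have h01 := congrArg (fun w => ip w (B s)) (hd 1)
  have h11 := congrArg (fun w => ip w (A s)) (hd 1)
  simp only [ip_add_left, ip_smul_left, ip_neg_left, hAB, hBB, hAA, ip_comm (B s) (A s), hb0,
    hb1, e1] at h00 h01 h11
  have m00 : m 0 0 = -(k₂ * ε) := by linarith
  have m01 : m 0 1 = 0 := by linarith
  have m11 : m 1 1 = -(k₂ * ε) := by linarith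
  have hmean : meanCurvature S (Φ (s, 0)) = -(k₂ * ε) := by
    rw [meanCurvature, htr, m00, m11]; ring
  rw [hmean, hdet, m00, m01, m11]
  exact ⟨by ring, neg_ne_zero.2 (mul_ne_zero hF.pos_k₂.ne' hε0)⟩

end BScroll

end LorentzSurface

end

/-! ### The four cases -/

open LorentzSurface in
theorem mainTheorem1 {M : Type*} [TopologicalSpace M] [ChartedSpace Plane M]
    [IsManifold (𝓡 2) ∞ M] (hM : IsOrientedAtlas M)
    (x : M → E42) (hx : IsLorentzianSurface x)
    (N : M → E42) (hN : IsUnitNormal x N)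
    (S : ∀ p : M, TangentSpace (𝓡 2) p →ₗ[ℝ] TangentSpace (𝓡 2) p) (hS : IsShapeOperator x N S)
    (hmean : ∃ h : ℝ, ∀ p, meanCurvature S p = h)
    (hgauss : ∃ K : ℝ, ∀ p, gaussianCurvature x p = K)
    (hdiag : ∃ p, ¬ IsDiagonalizable (S p))
    (ν : M → ⋀[ℝ]^3 E42) (hν : IsGaussMap x ν) :
    (IsComplexCircle x (-1) → IsOfType x 1 ν) ∧
    (∀ κ : ℂ, κ.re = -1 → κ ≠ -1 → IsComplexCircle x κ → IsInfiniteType x ν) ∧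
    (IsBScroll x → ¬ IsFlat x → IsOfNullType x 2 ν) ∧
    (IsBScroll x → IsFlat x → IsInfiniteType x ν) := by
  obtain ⟨h, hh⟩ := hmean
  obtain ⟨K, hK⟩ := hgauss
  have hd (p) : LinearMap.det (S p) = K + 1 := by
    rw [← hK p, gaussianCurvature_eq hx hN hS]; ring
  -- The discriminant of `S` is nonpositive at the non-diagonalizable point, and `h` and `K` are
  -- constant, so one point suffices.
  have hle : h ^ 2 ≤ K + 1 := by
    obtain ⟨p, hp⟩ := hdiag
    obtain ⟨e⟩ := exists_basis_tangentSpace p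
    have h1 := trace_sq_le_of_not_isDiagonalizable e hp
    have h2 := hh p
    rw [meanCurvature, div_eq_iff two_ne_zero] at h2
    rw [h2, hd] at h1
    linarith
  have hne : Nonempty M := hdiag.nonempty
  refine ⟨fun hc => ?_, fun κ hre hκ hc => ?_, fun hB hflat => ?_, fun hB hflat => ?_⟩
  · obtain ⟨p⟩ := hne
    have h0 : h = 0 := by
      rw [← hh p]
      exact (trace_det_of_isComplexCircle hx hN hS hc p).2.2 (by simp)
    -- For `h = 0` the matrix is diagonal and `N` alone is an eigenvector.
    refine ⟨fun _ => -2 * (K + 1),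
      fun _ p => orientSign x N p • hodgeStar ((1 : ℝ) • N p + (0 : ℝ) • x p),
      Function.injective_of_subsingleton _, one_pos, fun _ => ?_, fun p => ?_⟩
    · exact isEigenmap_combination hM hx hN hS hh hd hdiag one_ne_zero
        (by rw [h0]; ring) (by rw [h0]; ring)
    · simp [gaussMap_eq hx hN hν]
  · obtain ⟨p⟩ := id hne
    obtain ⟨h1, h2⟩ := trace_det_of_isComplexCircle hx hN hS hc p
    have h0 : h ≠ 0 := fun h0 => by
      rw [hh, h0] at h2
      exact hκ (Complex.ext (by simpa using hre) (by simpa using h2.1 rfl))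
    rw [hd] at h1
    exact isInfiniteType_of_flat hM hx hN hS hh (fun q => by rw [hd, h1]) h0 (h1 ▸ hle) hν
  · obtain ⟨p, h1, h0⟩ := trace_det_of_isBScroll hx hN hS hB
    rw [hh] at h0
    rw [hd, hh] at h1
    have hK0 : K ≠ 0 := fun hK0 => hflat fun q => by rw [hK, hK0]
    -- With `K + 1 = h²`, the eigenvectors are `N + h x` for `0` and `h² N + h x` for `2K`; scaled
    -- by `-K⁻¹` and `K⁻¹` they add up to `N`.
    refine ⟨![0, 2 * K],
      ![fun p => orientSign x N p • hodgeStar ((-K⁻¹) • N p + (-K⁻¹ * h) • x p),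
        fun p => orientSign x N p • hodgeStar ((K⁻¹ * h ^ 2) • N p + (K⁻¹ * h) • x p)],
      ?_, ⟨0, rfl⟩, two_pos, ?_, ?_⟩
    · intro i j hij
      fin_cases i <;> fin_cases j <;> simp_all
    · intro i
      have hKe : K = h ^ 2 - 1 := by linarith
      fin_cases i
      · exact isEigenmap_combination hM hx hN hS hh hd hdiag (by simpa using hK0)
          (by rw [h1]; simp only [Fin.zero_eta, Matrix.cons_val]; ring)
          (by simp only [Fin.zero_eta, Matrix.cons_val]; ring)
      · exact isEigenmap_combination hM hx hN hS hh hd hdiag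
          (mul_ne_zero (inv_ne_zero hK0) (pow_ne_zero 2 h0))
          (by rw [h1]; simp only [Matrix.cons_val, Fin.mk_one]
              linear_combination (-2 * K⁻¹ * h ^ 2) * hKe)
          (by simp only [Matrix.cons_val, Fin.mk_one]
              linear_combination (-2 * K⁻¹ * h) * hKe)
    · intro q
      rw [gaussMap_eq hx hN hν, Fin.sum_univ_two]
      simp only [Matrix.cons_val]
      rw [← smul_add, ← map_add]
      congr 2
      have e : N q = (K⁻¹ * (h ^ 2 - 1)) • N q := by
        rw [← h1, add_sub_cancel_right, inv_mul_cancel₀ hK0, one_smul]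
      nth_rewrite 1 [e]
      module
  · obtain ⟨p, -, h0⟩ := trace_det_of_isBScroll hx hN hS hB
    have hK0 : K = 0 := by rw [← hK p]; exact hflat p
    subst hK0
    rw [hh] at h0
    exact isInfiniteType_of_flat hM hx hN hS hh (fun q => by rw [hd, zero_add]) h0
      (by linarith) hν
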